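/- Let $N\ge 1$, let $E\subset\mathbb R^N$ be open, $T>0$, $E_T=E\times(0,T]$; local ("loc") statements refer to compact subsets of $E$ and $E_T$ and to intervals $[t_1,t_2]\subset(0,T]$. For $\rho>0$ let $K_\rho(y)$ be the (closed) cube with centre $y$ and edge $\rho$. Let $u\ge 0$ be measurable and locally bounded in $E_T$, with $$u\in L^r_{\rm loc}(E_T)\ \text{ for some } r>\max\{1,\tfrac N2\},\qquad \ln u\in L^\infty_{\rm loc}\big(0,T;L^p_{\rm loc}(E)\big),$$ where $\ln 0=-\infty$, so that $u>0$ a.e. For a cylinder $K_{2\rho}(y)\times[s,t]\subset E_T$ with $\rho>0$, $s<t$, put $$M=\operatorname*{ess\,sup}_{K_{2\rho}(y)\times(s,t]}u,\qquad \Lambda_q=\operatorname*{ess\,sup}_{s\le\tau\le t}\Big(\frac1{|K_{2\rho}(y)|}\int_{K_{2\rho}(y)}\Big|\ln\frac{u(x,\tau)}{M}\Big|^q dx\Big)^{1/q}.$$ (i) Let $p\ge2$, and let $u$ be a local weak solution of $u_t-\Delta\ln u=0$ in $E_T$, that is, $u\in C_{\rm loc}(0,T;L^2_{\rm loc}(E))$,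 $\ln u\in L^2_{\rm loc}(0,T;W^{1,2}_{\rm loc}(E))$, and, with $F=D\ln u$, $$\int_E u\varphi\,dx\Big|_{t_1}^{t_2}+\int_{t_1}^{t_2}\!\!\int_E\big(-u\varphi_t+F\cdot D\varphi\big)dx\,d\tau=0$$ for all $0<t_1<t_2\le T$ and all $\varphi\in C_c^\infty(E\times\mathbb R)$. Then there is a constant $\gamma>0$, depending only on $N,r,p,\Lambda_1,\Lambda_2$, such that for all cylinders $K_{2\rho}(y)\times[s,t]\subset E_T$ $$\sup_{s<\tau<t}\int_{K_\rho(y)}u(x,\tau)\,dx\le\gamma\Big(\inf_{s<\tau<t}\int_{K_{2\rho}(y)}u(x,\tau)\,dx+\frac{t-s}{\rho^{\lambda}}\Big),\qquad\lambda=2-N.$$ (ii) Let $C_o,C_1>0$ and let $A:E_T\times\mathbb R\times\mathbb R^N\to\mathbb R^N$ be (Borel) measurable such that, for a.e. $(x,t)\in E_T$, all $v>0$ and all $\xi\in\mathbb R^N$, $A(x,t,v,\xi)\cdot\xi\ge C_o|\xi|^2/v$ and $|A(x,t,v,\xi)|\le C_1|\xi|/v$. The same estimate holds if $p\ge2$ and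 $u$ is a local weak solution of $u_t-\operatorname{div}A(x,t,u,Du)=0$ in $E_T$ (same function spaces and identity as in (i), with $F=A(x,t,u,Du)$, $Du=u\,D\ln u$), with $\gamma$ depending only on $N,r,p,C_o,C_1,\Lambda_1,\Lambda_2$. (iii) Let $p>1$ and let $u$ be merely a distributional solution of $u_t-\Delta\ln u=0$, that is, $u,\ln u\in L^1_{\rm loc}(E_T)$ and $\iint(u\varphi_t+\ln u\,\Delta\varphi)\,dx\,d\tau=0$ for all $\varphi\in C_c^\infty(E\times(0,T))$. Then the same estimate holds, with $\sup$ and $\inf$ over $\tau$ read as essential supremum and essential infimum, and with $\gamma$ depending only on $N$ and $\Lambda_p$. -/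

import Mathlib

open MeasureTheory Set Filter Topology
open scoped ENNReal ContDiff

noncomputable section

namespace LogDiffusion

/-- The space `ℝ^N` with its Euclidean structure. -/
abbrev Sp (N : ℕ) : Type := EuclideanSpace ℝ (Fin N)

variable {N : ℕ}

/-- The space-time cylinder `E_T = E × (0, T]`. -/
def cyl (E : Set (Sp N)) (T : ℝ) : Set (Sp N × ℝ) := E ×ˢ Ioc 0 T

/-- The (closed) cube `K_ρ(y)` centred at `y`, with edge `ρ`. -/
def cube (y : Sp N) (ρ : ℝ) : Set (Sp N) := {x | ∀ i, |x i - y i| ≤ ρ / 2}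

/-- `f ∈ L^q_loc(E_T)`: `f` is in `L^q` of every compact subset of `E_T = E × (0, T]`.
For `q = ∞` this is local (essential) boundedness. -/
def MemLpLoc {F : Type*} [NormedAddCommGroup F] (E : Set (Sp N)) (T : ℝ) (f : Sp N → ℝ → F)
    (q : ℝ≥0∞) : Prop :=
  ∀ Q : Set (Sp N × ℝ), IsCompact Q → Q ⊆ cyl E T →
    MemLp (fun z : Sp N × ℝ => f z.1 z.2) q (volume.restrict Q)

/-- `u ∈ C_loc(0, T; L^2_loc(E))`: for every compact `K ⊆ E`, the map `τ ↦ u(·, τ)` is continuous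
from `(0, T]` to `L^2(K)`. -/
def MemCLoc (E : Set (Sp N)) (T : ℝ) (u : Sp N → ℝ → ℝ) : Prop :=
  ∀ K : Set (Sp N), IsCompact K → K ⊆ E →
    (∀ τ ∈ Ioc 0 T, MemLp (fun x => u x τ) 2 (volume.restrict K)) ∧
    ∀ τ₀ ∈ Ioc 0 T,
      Tendsto (fun τ => eLpNorm (fun x => u x τ - u x τ₀) 2 (volume.restrict K))
        (𝓝[Ioc 0 T] τ₀) (𝓝 0)

/-- `w ∈ L^∞_loc(0, T; L^p_loc(E))`: `w` is measurable on `E_T`, and for every compact `K ⊆ E` and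
every `[t₁, t₂] ⊆ (0, T]` the norm `‖w(·, τ)‖_{L^p(K)}` is essentially bounded for
`τ ∈ [t₁, t₂]`. -/
def MemLinftyLpLoc (E : Set (Sp N)) (T : ℝ) (w : Sp N → ℝ → ℝ) (p : ℝ) : Prop :=
  AEStronglyMeasurable (fun z : Sp N × ℝ => w z.1 z.2) (volume.restrict (cyl E T)) ∧
  ∀ K : Set (Sp N), IsCompact K → K ⊆ E → ∀ t₁ t₂ : ℝ, 0 < t₁ → t₂ ≤ T →
    essSup (fun τ => eLpNorm (fun x => w x τ) (ENNReal.ofReal p) (volume.restrict K))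
      (volume.restrict (Icc t₁ t₂)) < (⊤ : ℝ≥0∞)

/-- `g` is the weak gradient of `w` in the open set `E`. -/
def IsWeakGradient (E : Set (Sp N)) (w : Sp N → ℝ) (g : Sp N → Sp N) : Prop :=
  ∀ φ : Sp N → ℝ, ContDiff ℝ ∞ φ → HasCompactSupport φ → tsupport φ ⊆ E →
    ∫ x in E, w x • gradient φ x = - ∫ x in E, φ x • g x

/-- `w ∈ L^2_loc(0, T; W^{1,2}_loc(E))`, with weak spatial gradient `G`. -/
structure MemL2W12Loc (E : Set (Sp N)) (T : ℝ) (w : Sp N → ℝ → ℝ) (G : Sp N → ℝ → Sp N) :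
    Prop where
  memLp : MemLpLoc E T w 2
  memLp_grad : MemLpLoc E T G 2
  weakGradient : ∀ᵐ τ ∂(volume.restrict (Ioc 0 T)),
    IsWeakGradient E (fun x => w x τ) (fun x => G x τ)

/-- `u ≥ 0` a.e. in `E_T`, and `ln u` is a.e. finite, that is, `u ≠ 0` a.e. in `E_T`. (The latter is
part of any assertion that `ln u`, with `ln 0 = -∞`, is locally integrable; it has to be stated
because `Real.log 0 = 0`.) -/
structure NonnegLogFinite (E : Set (Sp N)) (T : ℝ) (u : Sp N → ℝ → ℝ) : Prop where
  nonneg : ∀ᵐ z ∂(volume.restrict (cyl E T)), 0 ≤ u z.1 z.2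
  ne_zero : ∀ᵐ z ∂(volume.restrict (cyl E T)), u z.1 z.2 ≠ 0

/-- `u_t - div F = 0` weakly in `E_T`: for all `0 < t₁ < t₂ ≤ T` and all test functions `φ`
that are smooth on `E × ℝ`, with compact support there,
`∫_E u φ dx |_{t₁}^{t₂} + ∫_{t₁}^{t₂} ∫_E (- u φ_t + F · Dφ) dx dτ = 0`. -/
def WeakEquation (E : Set (Sp N)) (T : ℝ) (u : Sp N → ℝ → ℝ) (F : Sp N → ℝ → Sp N) : Prop :=
  ∀ φ : Sp N × ℝ → ℝ, ContDiff ℝ ∞ φ → HasCompactSupport φ → tsupport φ ⊆ E ×ˢ univ →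
    ∀ t₁ t₂ : ℝ, 0 < t₁ → t₁ < t₂ → t₂ ≤ T →
      (∫ x in E, u x t₂ * φ (x, t₂)) - (∫ x in E, u x t₁ * φ (x, t₁))
        + ∫ z in E ×ˢ Ioc t₁ t₂,
            (- u z.1 z.2 * deriv (fun τ => φ (z.1, τ)) z.2
              + inner ℝ (F z.1 z.2) (gradient (fun x => φ (x, z.2)) z.1)) = 0

/-- Non-negative local weak solutions of `u_t - Δ ln u = 0` in `E_T`. -/
structure IsLocalWeakSolution (E : Set (Sp N)) (T : ℝ) (u : Sp N → ℝ → ℝ) : Prop where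
  nonnegLogFinite : NonnegLogFinite E T u
  memCLoc : MemCLoc E T u
  exists_grad : ∃ G : Sp N → ℝ → Sp N,
    MemL2W12Loc E T (fun x τ => Real.log (u x τ)) G ∧ WeakEquation E T u G

/-- The structure conditions on the field `A(x, t, v, ξ)`: it is (Borel) measurable and, for a.e.
`(x, t) ∈ E_T`, all `v > 0` and all `ξ ∈ ℝ^N`, `A · ξ ≥ C_o |ξ|² / v` and
`|A| ≤ C_1 |ξ| / v`. (Only the values of `A` for `(x, t) ∈ E_T` and `v > 0` matter; elsewhere `A` can
be taken to be `0`.) -/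
structure StructureConditions (E : Set (Sp N)) (T : ℝ) (A : Sp N → ℝ → ℝ → Sp N → Sp N)
    (Co C1 : ℝ) : Prop where
  measurable : Measurable (fun q : Sp N × ℝ × ℝ × Sp N => A q.1 q.2.1 q.2.2.1 q.2.2.2)
  coercive : ∀ᵐ z ∂(volume.restrict (cyl E T)), ∀ v : ℝ, 0 < v → ∀ ξ : Sp N,
    Co * (‖ξ‖ ^ 2 / v) ≤ inner ℝ (A z.1 z.2 v ξ) ξ
  growth : ∀ᵐ z ∂(volume.restrict (cyl E T)), ∀ v : ℝ, 0 < v → ∀ ξ : Sp N,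
    ‖A z.1 z.2 v ξ‖ ≤ C1 * (‖ξ‖ / v)

/-- Non-negative local weak solutions of `u_t - div A(x, t, u, Du) = 0` in `E_T`. Here
`Du = u D(ln u)`, where `D(ln u)` is the weak gradient of `ln u ∈ L^2_loc(0, T; W^{1,2}_loc(E))`. -/
structure IsLocalWeakSolutionQuasilinear (E : Set (Sp N)) (T : ℝ)
    (A : Sp N → ℝ → ℝ → Sp N → Sp N) (u : Sp N → ℝ → ℝ) : Prop where
  nonnegLogFinite : NonnegLogFinite E T u
  memCLoc : MemCLoc E T u
  exists_grad : ∃ G : Sp N → ℝ → Sp N,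
    MemL2W12Loc E T (fun x τ => Real.log (u x τ)) G ∧
    WeakEquation E T u (fun x τ => A x τ (u x τ) (u x τ • G x τ))

/-- Non-negative distributional solutions of `u_t - Δ ln u = 0` in `E_T`: `u` and `ln u` are merely
in `L^1_loc(E_T)`, and `∫∫ (u φ_t + ln u Δφ) dx dτ = 0` for all
`φ ∈ C_c^∞(E × (0, T))`. -/
structure IsDistributionalSolution (E : Set (Sp N)) (T : ℝ) (u : Sp N → ℝ → ℝ) : Prop where
  nonnegLogFinite : NonnegLogFinite E T u
  memLp : MemLpLoc E T u 1
  memLp_log : MemLpLoc E T (fun x τ => Real.log (u x τ)) 1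
  equation : ∀ φ : Sp N × ℝ → ℝ, ContDiff ℝ ∞ φ → HasCompactSupport φ →
    tsupport φ ⊆ E ×ˢ Ioo 0 T →
      ∫ z in E ×ˢ Ioo 0 T,
        (u z.1 z.2 * deriv (fun τ => φ (z.1, τ)) z.2
          + Real.log (u z.1 z.2) * Laplacian.laplacian (fun x => φ (x, z.2)) z.1) = 0

/-- `M = ess sup` of `u` over `K_{2ρ}(y) × (s, t]`. -/
def supM (u : Sp N → ℝ → ℝ) (y : Sp N) (ρ s t : ℝ) : ℝ :=
  (essSup (fun z : Sp N × ℝ => ENNReal.ofReal (u z.1 z.2))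
    (volume.restrict (cube y (2 * ρ) ×ˢ Ioc s t))).toReal

/-- `Λ_q = ess sup_{s ≤ τ ≤ t} (⨍_{K_{2ρ}(y)} |ln (u(x, τ) / M)|^q dx)^{1/q}`. -/
def Lam (u : Sp N → ℝ → ℝ) (y : Sp N) (ρ s t q : ℝ) : ℝ :=
  (essSup
    (fun τ => (⨍⁻ x in cube y (2 * ρ),
      ENNReal.ofReal |Real.log (u x τ / supM u y ρ s t)| ^ q ∂volume) ^ (1 / q))
    (volume.restrict (Icc s t))).toReal

/-- `∫_{K_ρ(y)} u(x, τ) dx`, as an element of `[0, ∞]`. -/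
def mass (u : Sp N → ℝ → ℝ) (y : Sp N) (ρ τ : ℝ) : ℝ≥0∞ :=
  ∫⁻ x in cube y ρ, ENNReal.ofReal (u x τ)

end LogDiffusion

end

/-! For weak solutions, write `w = ln u`, `G = Dw`, and let `m(τ) = ∫ u η²` be the mass localized by
a cutoff `η` between the two cubes. The equation tested with `η²` alone bounds `|m(τ₁) - m(τ₂)|` by
`2 C₁ I`, where `I = ∬ |G| η |Dη|`, so everything reduces to an estimate of `I`. It comes from the
test function `arctan(w - ln M) η²`. Since `arctan` is bounded, the time term is at most a multiple
of `sup m`. Since its derivative is `1 / (1 + (w - ln M)²)`, coercivity gives `∬ |G|² η² / (1 + (w -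
ln M)²)`. Young's inequality with this weight then bounds `I` by that integral plus `∬ (1 + (w - ln
M)²) |Dη|²`, and the last integral is of order `(1 + Λ₂²) ρ^(N-2) (t - s)`. Finally `sup m ≤ m(τ₂) +
2 C₁ I`, and the constants are arranged so that the `I` produced there is absorbed. This is
`WeakData.mass_le`.

The test function is not smooth and `u_t` is not a function. In space, `w` is mollified
(`integral_test_comp`). In time, the equation is used between `τ - h` and `τ`, convexity of the
primitive of `f ∘ log` replaces the chain rule (`logPrimitive_sub_le`, `steklov_energy_le`), and
then `h → 0` (`energy_le`). The model equation is the case `A = ξ / v` of the quasilinear one.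

For distributional solutions no gradient is available, but none is needed: `∫ u η` has the weak time
derivative `∫ ln u Δη = ∫ ln(u / M) Δη`, because `∫ Δη = 0`. It is bounded by a multiple of `ρ^(N-2)
Λ_p`, so the localized mass is Lipschitz in time up to a null set (`ae_abs_sub_le_of_weak_deriv`).
-/

namespace LogDiffusion

/-! ### L² convergence of averages over small translates -/

section Averages

variable {V F : Type*} [NormedAddCommGroup V] [MeasurableSpace V] [BorelSpace V]
  [SecondCountableTopology V] [NormedAddCommGroup F] {μ : Measure V} [μ.IsAddLeftInvariant]

/-- Translations act continuously on `Lp` for finite exponent, through `DomAddAct`; this is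
continuity at `0` of the orbit of `g`. -/
theorem tendsto_eLpNorm_translate_sub [IsLocallyFiniteMeasure μ] [μ.InnerRegularCompactLTTop]
    {g : V → F} (hg : MemLp g 2 μ) :
    Tendsto (fun h => eLpNorm (fun z => g (z - h) - g z) 2 μ) (𝓝 0) (𝓝 0) := by
  have : Fact ((2 : ℝ≥0∞) ≠ ⊤) := ⟨by simp⟩
  have hc : Continuous (fun h : V => (DomAddAct.mk (-h) : Vᵈᵃᵃ) +ᵥ hg.toLp g) :=
    Continuous.vadd (DomAddAct.mkHomeomorph.continuous.comp continuous_neg) continuous_const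
  have h0 := (hc.tendsto 0).edist (tendsto_const_nhds (x := hg.toLp g))
  have hz : (DomAddAct.mk (-(0 : V)) : Vᵈᵃᵃ) +ᵥ hg.toLp g = hg.toLp g := by simp
  rw [hz, edist_self] at h0
  refine h0.congr fun h => ?_
  rw [DomAddAct.mk_vadd_toLp, Lp.edist_toLp_toLp]
  refine congrArg (fun k => eLpNorm k 2 μ) ?_
  ext z
  simp [sub_eq_neg_add]

theorem eLpNorm_two_sq {α : Type*} [MeasurableSpace α] (ν : Measure α) (f : α → F) :
    eLpNorm f 2 ν ^ 2 = ∫⁻ a, ‖f a‖ₑ ^ 2 ∂ν := by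
  rw [eLpNorm_eq_lintegral_rpow_enorm_toReal (by simp) (by simp), ← ENNReal.rpow_natCast,
    ← ENNReal.rpow_mul]
  simp

theorem lintegral_sq_le {Θ : Type*} [MeasurableSpace Θ] (κ : Measure Θ) [IsProbabilityMeasure κ] {f : Θ → F}
    (hf : AEStronglyMeasurable f κ) : (∫⁻ a, ‖f a‖ₑ ∂κ) ^ 2 ≤ ∫⁻ a, ‖f a‖ₑ ^ 2 ∂κ := by
  rw [← eLpNorm_two_sq, ← eLpNorm_one_eq_lintegral_enorm]
  gcongr
  exact eLpNorm_le_eLpNorm_of_exponent_le (by norm_num) hf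

variable {Θ : Type*} [NormedSpace ℝ F] [CompleteSpace F] [MeasurableSpace Θ] [SFinite μ]

theorem quasiMeasurePreserving_sub_shift (κ : Measure Θ) [SFinite κ] {sh : Θ → V}
    (hsh : Measurable sh) :
    Measure.QuasiMeasurePreserving (fun q : V × Θ => q.1 - sh q.2) (μ.prod κ) μ := by
  refine QuasiMeasurePreserving.prod_of_left (by fun_prop) (ae_of_all _ fun θ => ?_)
  exact (measurePreserving_sub_right μ (sh θ)).quasiMeasurePreserving

/-- By Jensen in `θ`, the square of the averaged difference is at most the average of the squares;
after Tonelli each translate contributes at most `ε²`. -/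
theorem eLpNorm_average_sub_sq_le {g : V → F} (hg : MemLp g 2 μ) (κ : Measure Θ)
    [IsProbabilityMeasure κ] {sh : Θ → V} (hsh : Measurable sh) {ε : ℝ≥0∞} (hε : ε ≠ ⊤)
    (h : ∀ᵐ θ ∂κ, eLpNorm (fun z => g (z - sh θ) - g z) 2 μ ≤ ε) :
    AEStronglyMeasurable (fun z => ∫ θ, g (z - sh θ) ∂κ) μ ∧
    eLpNorm (fun z => (∫ θ, g (z - sh θ) ∂κ) - g z) 2 μ ^ 2 ≤ ε ^ 2 := by
  have hm : AEStronglyMeasurable (fun q : V × Θ => g (q.1 - sh q.2)) (μ.prod κ) :=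
    hg.1.comp_quasiMeasurePreserving (quasiMeasurePreserving_sub_shift κ hsh)
  have hm2 : AEStronglyMeasurable (fun q : V × Θ => g (q.1 - sh q.2) - g q.1) (μ.prod κ) :=
    hm.sub hg.1.comp_fst
  refine ⟨hm.integral_prod_right', ?_⟩
  have hT : ∫⁻ z, ∫⁻ θ, ‖g (z - sh θ) - g z‖ₑ ^ 2 ∂κ ∂μ ≤ ε ^ 2 := by
    rw [lintegral_lintegral_swap (by exact hm2.enorm.pow_const 2)]
    calc ∫⁻ θ, ∫⁻ z, ‖g (z - sh θ) - g z‖ₑ ^ 2 ∂μ ∂κ ≤ ∫⁻ _, ε ^ 2 ∂κ := by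
          refine lintegral_mono_ae ?_
          filter_upwards [h] with θ hθ
          rw [← eLpNorm_two_sq μ (fun z => g (z - sh θ) - g z)]
          gcongr
      _ = ε ^ 2 := by simp
  -- Finiteness for a.e. `z` makes `θ ↦ g (z - sh θ)` integrable; otherwise its Bochner integral
  -- would be the default value `0` and `g z` could not be moved under the integral.
  have hfin : ∀ᵐ z ∂μ, ∫⁻ θ, ‖g (z - sh θ) - g z‖ₑ ^ 2 ∂κ < ⊤ := by
    refine ae_lt_top' ?_ (hT.trans_lt (ENNReal.pow_lt_top hε.lt_top)).ne
    exact (hm2.enorm.pow_const 2).lintegral_prod_right'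
  rw [eLpNorm_two_sq]
  refine (lintegral_mono_ae ?_).trans hT
  have hsec : ∀ᵐ z ∂μ, AEStronglyMeasurable (fun θ => g (z - sh θ) - g z) κ := hm2.prodMk_left
  filter_upwards [hfin, hsec] with z hz hmz
  have hi : Integrable (fun θ => g (z - sh θ) - g z) κ := by
    refine MemLp.integrable (q := 2) (by norm_num) ⟨hmz, ?_⟩
    have := eLpNorm_two_sq κ (fun θ => g (z - sh θ) - g z)
    rw [← this] at hz
    exact (ENNReal.pow_lt_top_iff.1 hz).resolve_right (by norm_num)
  have hi' : Integrable (fun θ => g (z - sh θ)) κ := by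
    exact (hi.add (integrable_const (g z))).congr (ae_of_all _ fun θ => by simp)
  have : (∫ θ, g (z - sh θ) ∂κ) - g z = ∫ θ, (g (z - sh θ) - g z) ∂κ := by
    rw [integral_sub hi' (integrable_const _)]; simp
  rw [this]
  calc ‖∫ θ, (g (z - sh θ) - g z) ∂κ‖ₑ ^ 2 ≤ (∫⁻ θ, ‖g (z - sh θ) - g z‖ₑ ∂κ) ^ 2 := by
        gcongr; exact enorm_integral_le_lintegral_enorm _
    _ ≤ _ := lintegral_sq_le κ hmz

/-- Averages of `g` over translates, taken with respect to probability measures that concentrate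
near `0`, converge to `g` in `L²`. -/
theorem tendsto_average [IsLocallyFiniteMeasure μ] [μ.InnerRegularCompactLTTop] {g : V → F} (hg : MemLp g 2 μ) {κ : ℕ → Measure Θ}
    [∀ n, IsProbabilityMeasure (κ n)] {sh : Θ → V} (hsh : Measurable sh) {δ : ℕ → ℝ}
    (hδ : Tendsto δ atTop (𝓝 0)) (hκ : ∀ n, ∀ᵐ θ ∂(κ n), ‖sh θ‖ ≤ δ n) :
    (∀ᶠ n in atTop, MemLp (fun z => ∫ θ, g (z - sh θ) ∂(κ n)) 2 μ) ∧
    Tendsto (fun n => eLpNorm (fun z => (∫ θ, g (z - sh θ) ∂(κ n)) - g z) 2 μ) atTop (𝓝 0) := by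
  have key : ∀ ε : ℝ≥0∞, 0 < ε → ε ≠ ⊤ → ∀ᶠ n in atTop,
      AEStronglyMeasurable (fun z => ∫ θ, g (z - sh θ) ∂(κ n)) μ ∧
      eLpNorm (fun z => (∫ θ, g (z - sh θ) ∂(κ n)) - g z) 2 μ ≤ ε := by
    intro ε hε hε'
    have h1 := ENNReal.tendsto_nhds_zero.1 (tendsto_eLpNorm_translate_sub hg) ε hε
    obtain ⟨r, hr, hb⟩ := Metric.eventually_nhds_iff.1 h1
    filter_upwards [hδ.eventually (gt_mem_nhds hr)] with n hn
    obtain ⟨h2, h3⟩ := eLpNorm_average_sub_sq_le hg (κ n) hsh hε' (by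
      filter_upwards [hκ n] with θ hθ
      exact hb (by simpa using hθ.trans_lt hn))
    exact ⟨h2, (ENNReal.pow_le_pow_left_iff (by norm_num)).1 h3⟩
  constructor
  · filter_upwards [key 1 (by simp) (by simp)] with n hn
    have : MemLp (fun z => (∫ θ, g (z - sh θ) ∂(κ n)) - g z) 2 μ :=
      ⟨hn.1.sub hg.1, hn.2.trans_lt (by simp)⟩
    exact (this.add hg).ae_eq (ae_of_all _ fun z => by simp)
  · refine ENNReal.tendsto_nhds_zero.2 fun ε hε => ?_
    -- `key` requires a finite `ε`, hence the minimum with `1`.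
    filter_upwards [key (min ε 1) (lt_min hε (by simp))
      (ne_top_of_le_ne_top ENNReal.one_ne_top (min_le_right _ _))] with n hn
    exact hn.2.trans (min_le_left _ _)

end Averages

/-! ### Mollification and weak gradients -/

section Mollify

/-- A sequence of bump functions whose supports shrink to `0`. -/
noncomputable def bump (V : Type*) [NormedAddCommGroup V] (n : ℕ) : ContDiffBump (0 : V) where
  rIn := 1 / ((n : ℝ) + 1)
  rOut := 2 * (1 / ((n : ℝ) + 1))
  rIn_pos := by positivity
  rIn_lt_rOut := by
    have : (0 : ℝ) < 1 / ((n : ℝ) + 1) := by positivity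
    linarith

theorem tendsto_bump_rOut {V : Type*} [NormedAddCommGroup V] : Tendsto (fun n => (bump V n).rOut) atTop (𝓝 0) := by
  have := (tendsto_one_div_add_atTop_nhds_zero_nat (𝕜 := ℝ)).const_mul 2
  simpa [bump] using this

variable {V : Type*} [NormedAddCommGroup V] [InnerProductSpace ℝ V] [FiniteDimensional ℝ V]
  [MeasurableSpace V] [BorelSpace V]
  {F : Type*} [NormedAddCommGroup F] [NormedSpace ℝ F]

/-- The standard mollification of a function. -/
noncomputable def moll (n : ℕ) (g : V → F) : V → F :=
  convolution ((bump V n).normed volume) g (ContinuousLinearMap.lsmul ℝ ℝ) volume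

theorem moll_eq (n : ℕ) (g : V → F) (x : V) :
    moll n g x = ∫ t, (bump V n).normed volume (x - t) • g t :=
  convolution_lsmul_swap

theorem ae_tendsto_moll [CompleteSpace F] {g : V → F} (hg : LocallyIntegrable g volume) :
    ∀ᵐ x, Tendsto (fun n => moll n g x) atTop (𝓝 (g x)) :=
  ContDiffBump.ae_convolution_tendsto_right_of_locallyIntegrable tendsto_bump_rOut
    (Eventually.of_forall fun _ => le_refl _) hg

theorem contDiff_moll {g : V → F} (hg : LocallyIntegrable g volume) (n : ℕ) :
    ContDiff ℝ ∞ (moll n g) :=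
  (bump V n).hasCompactSupport_normed.contDiff_convolution_left _ ((bump V n).contDiff_normed) hg

/-- Convolution with a normalized bump is an average over translates for the probability measure
whose density is the bump, so `tendsto_average` applies. -/
theorem tendsto_eLpNorm_moll_sub [CompleteSpace F] {g : V → F} (hg : MemLp g 2 volume) :
    (∀ᶠ n in atTop, MemLp (moll n g) 2 volume) ∧
    Tendsto (fun n => eLpNorm (fun x => moll n g x - g x) 2 volume) atTop (𝓝 0) := by
  let κ : ℕ → Measure V := fun n =>
    volume.withDensity fun x => ENNReal.ofReal ((bump V n).normed volume x)
  have hp : ∀ n, IsProbabilityMeasure (κ n) := fun n => by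
    refine ⟨?_⟩
    rw [withDensity_apply _ MeasurableSet.univ, Measure.restrict_univ,
      ← ofReal_integral_eq_lintegral_ofReal (bump V n).integrable_normed
        (ae_of_all _ (bump V n).nonneg_normed), (bump V n).integral_normed, ENNReal.ofReal_one]
  have hmeas : ∀ n, Measurable fun x => ENNReal.ofReal ((bump V n).normed volume x) := fun n =>
    (bump V n).continuous_normed.measurable.ennreal_ofReal
  have heq : ∀ n x, moll n g x = ∫ θ, g (x - θ) ∂(κ n) := fun n x => by
    rw [integral_withDensity_eq_integral_toReal_smul (hmeas n) (by simp)]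
    simp only [ENNReal.toReal_ofReal ((bump V n).nonneg_normed _)]
    rfl
  have h := tendsto_average hg (κ := κ) measurable_id tendsto_bump_rOut (fun n => by
    refine (ae_withDensity_iff (hmeas n)).2 (ae_of_all _ fun x hx => ?_)
    have : x ∈ Function.support ((bump V n).normed volume) := by
      intro h0; simp [h0] at hx
    rw [ContDiffBump.support_normed_eq] at this
    simpa using (mem_ball_zero_iff.1 this).le)
  have heq' : ∀ n, moll n g = fun x => ∫ θ, g (x - θ) ∂(κ n) := fun n => funext (heq n)
  simpa only [heq', id] using h

/-- The derivative falls on the kernel, and `z ↦ ψ (x - z)` is an admissible test function as soon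
as the ball carrying it lies in `K`. The sign from differentiating in `x - z` cancels the sign in
the definition of the weak gradient. -/
theorem fderiv_moll {w : V → ℝ} {g : V → V} {K : Set V} (hw : LocallyIntegrable w volume)
    (hg : LocallyIntegrable g volume)
    (hwg : ∀ φ : V → ℝ, ContDiff ℝ ∞ φ → HasCompactSupport φ → tsupport φ ⊆ K →
      ∫ x, w x • gradient φ x = -∫ x, φ x • g x)
    {n : ℕ} {x : V} (hx : Metric.closedBall x (bump V n).rOut ⊆ K) :
    gradient (moll n w) x = moll n g x := by
  set ψ := (bump V n).normed volume with hψ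
  have hψs : ContDiff ℝ ∞ ψ := (bump V n).contDiff_normed
  have hψc : HasCompactSupport ψ := (bump V n).hasCompactSupport_normed
  have hD := hψc.hasFDerivAt_convolution_left (ContinuousLinearMap.lsmul ℝ ℝ)
    (hψs.of_le (by exact_mod_cast le_top)) hw x
  let φ : V → ℝ := fun z => ψ (x - z)
  have hφs : ContDiff ℝ ∞ φ := hψs.comp (contDiff_const.sub contDiff_id)
  have hφc : HasCompactSupport φ := hψc.comp_homeomorph (Homeomorph.subLeft x)
  have hφK : tsupport φ ⊆ K := by
    refine (closure_minimal ?_ Metric.isClosed_closedBall).trans hx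
    intro z hz
    have h1 : x - z ∈ Function.support ψ := hz
    rw [hψ, ContDiffBump.support_normed_eq, mem_ball_zero_iff] at h1
    rw [Metric.mem_closedBall, dist_comm, dist_eq_norm]
    exact h1.le
  have hgr := hwg φ hφs hφc hφK
  have hφd : ∀ z v, inner ℝ (gradient φ z) v = -(fderiv ℝ ψ (x - z) v) := fun z v => by
    rw [inner_gradient_left]
    have h1 : HasFDerivAt φ ((fderiv ℝ ψ (x - z)).comp (-ContinuousLinearMap.id ℝ V)) z :=
      ((hψs.differentiable (by simp)).differentiableAt.hasFDerivAt).comp z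
        ((hasFDerivAt_id z).const_sub x)
    rw [h1.fderiv]; simp
  have hgφ : Continuous (gradient φ) :=
    (InnerProductSpace.toDual ℝ V).symm.continuous.comp (hφs.continuous_fderiv (by simp))
  have hgφc : HasCompactSupport (gradient φ) :=
    (hφc.fderiv ℝ).comp_left (g := (InnerProductSpace.toDual ℝ V).symm) (map_zero _)
  have hi1 : Integrable (fun z => w z • gradient φ z) volume :=
    hw.integrable_smul_right_of_hasCompactSupport hgφ hgφc
  have hi2 : Integrable (fun z => φ z • g z) volume :=
    hg.integrable_smul_left_of_hasCompactSupport hφs.continuous hφc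
  refine ext_inner_right ℝ fun v => ?_
  rw [inner_gradient_left]
  have hfd : fderiv ℝ (moll n w) x = _ := hD.fderiv
  rw [hfd, moll_eq]
  have hce : ConvolutionExistsAt (fderiv ℝ ψ) w x
      ((ContinuousLinearMap.lsmul ℝ ℝ).precompL V) volume :=
    (hψc.fderiv ℝ).convolutionExists_left _ (hψs.continuous_fderiv (by simp)) hw x
  rw [convolution_def, ContinuousLinearMap.integral_apply hce]
  have e1 : ∫ t, ((ContinuousLinearMap.lsmul ℝ ℝ).precompL V (fderiv ℝ ψ t)) (w (x - t)) v
      = ∫ z, fderiv ℝ ψ (x - z) v * w z := by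
    rw [← integral_sub_left_eq_self _ volume x]
    simp
  rw [e1]
  have e2 : ∫ z, fderiv ℝ ψ (x - z) v * w z = -inner ℝ (∫ z, w z • gradient φ z) v := by
    rw [real_inner_comm, ← integral_inner hi1, ← integral_neg]
    refine integral_congr_ae (ae_of_all _ fun z => ?_)
    simp only [inner_smul_right]
    rw [real_inner_comm, hφd]; ring
  rw [e2, hgr]
  simp [φ, ψ]

end Mollify

/-! ### Pairings of L² fields and calculus of gradients -/

section InnerIntegrals

variable {α H : Type*} [MeasurableSpace α] {μ : Measure α} [NormedAddCommGroup H]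
  [InnerProductSpace ℝ H]

theorem integrable_inner_of_memLp {a b : α → H} (ha : MemLp a 2 μ) (hb : MemLp b 2 μ) :
    Integrable (fun x => inner ℝ (a x) (b x)) μ := by
  refine (L2.integrable_inner (𝕜 := ℝ) (ha.toLp a) (hb.toLp b)).congr ?_
  filter_upwards [ha.coeFn_toLp, hb.coeFn_toLp] with x h1 h2
  rw [h1, h2]

theorem enorm_integral_inner_le {a b : α → H} (ha : MemLp a 2 μ) (hb : MemLp b 2 μ) :
    ‖∫ x, inner ℝ (a x) (b x) ∂μ‖ₑ ≤ eLpNorm a 2 μ * eLpNorm b 2 μ := by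
  have h1 : ∫ x, inner ℝ (a x) (b x) ∂μ = inner ℝ (ha.toLp a) (hb.toLp b) := by
    rw [L2.inner_def]
    refine integral_congr_ae ?_
    filter_upwards [ha.coeFn_toLp, hb.coeFn_toLp] with x h1 h2
    rw [h1, h2]
  rw [h1, ← Lp.enorm_toLp ha, ← Lp.enorm_toLp hb]
  simp only [enorm_eq_nnnorm]
  exact_mod_cast norm_inner_le_norm (𝕜 := ℝ) (ha.toLp a) (hb.toLp b)

/-- Cauchy–Schwarz. The factor `a n` need not converge, it only has to stay below a fixed L²
function; this disposes of the error terms from mollification and from Steklov averaging. -/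
theorem tendsto_integral_inner_zero {P : α → H} (hP : MemLp P 2 μ) {C : ℝ} {a b : ℕ → α → H}
    (ha : ∀ n, AEStronglyMeasurable (a n) μ) (haP : ∀ n, ∀ᵐ x ∂μ, ‖a n x‖ ≤ C * ‖P x‖)
    (hb : ∀ᶠ n in atTop, MemLp (b n) 2 μ)
    (hb0 : Tendsto (fun n => eLpNorm (b n) 2 μ) atTop (𝓝 0)) :
    Tendsto (fun n => ∫ x, inner ℝ (a n x) (b n x) ∂μ) atTop (𝓝 0) := by
  rw [tendsto_zero_iff_enorm_tendsto_zero]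
  have hlim : Tendsto (fun n => ENNReal.ofReal C * eLpNorm P 2 μ * eLpNorm (b n) 2 μ) atTop
      (𝓝 0) := by
    have := ENNReal.Tendsto.const_mul (a := ENNReal.ofReal C * eLpNorm P 2 μ) hb0
      (Or.inr (ENNReal.mul_ne_top ENNReal.ofReal_ne_top hP.2.ne))
    simpa using this
  refine tendsto_of_tendsto_of_tendsto_of_le_of_le' tendsto_const_nhds hlim
    (Eventually.of_forall fun _ => zero_le) ?_
  filter_upwards [hb] with n hn
  refine (enorm_integral_inner_le (hP.of_le_mul (ha n) (haP n)) hn).trans ?_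
  gcongr
  exact eLpNorm_le_mul_eLpNorm_of_ae_le_mul (haP n) 2

end InnerIntegrals

section Gradient
variable {V : Type*} [NormedAddCommGroup V] [InnerProductSpace ℝ V] [CompleteSpace V]

theorem gradient_mul_comp {f : ℝ → ℝ} {w ζ : V → ℝ} {x : V} (hf : Differentiable ℝ f)
    (hw : DifferentiableAt ℝ w x) (hζ : DifferentiableAt ℝ ζ x) :
    gradient (fun x => f (w x) * ζ x) x =
      (deriv f (w x) * ζ x) • gradient w x + f (w x) • gradient ζ x := by
  have h1 := ((hf (w x)).hasDerivAt.comp_hasFDerivAt x hw.hasFDerivAt).mul hζ.hasFDerivAt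
  refine ext_inner_right ℝ fun v => ?_
  rw [inner_gradient_left, inner_add_left, inner_smul_left, inner_smul_left, inner_gradient_left,
    inner_gradient_left]
  have h2 : fderiv ℝ (fun x => f (w x) * ζ x) x = _ := h1.fderiv
  rw [h2]
  simp
  ring

theorem continuous_gradient {φ : V → ℝ} (hφ : ContDiff ℝ ∞ φ) : Continuous (gradient φ) :=
  (InnerProductSpace.toDual ℝ V).symm.continuous.comp (hφ.continuous_fderiv (by simp))

theorem hasCompactSupport_gradient {φ : V → ℝ} (hφ : HasCompactSupport φ) :
    HasCompactSupport (gradient φ) :=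
  (hφ.fderiv ℝ).comp_left (g := (InnerProductSpace.toDual ℝ V).symm) (map_zero _)

theorem norm_gradient (φ : V → ℝ) (x : V) : ‖gradient φ x‖ = ‖fderiv ℝ φ x‖ :=
  (InnerProductSpace.toDual ℝ V).symm.norm_map _

end Gradient

/-! ### Non-smooth test functions at a fixed time -/

section Slice

variable {V : Type*} [NormedAddCommGroup V] [InnerProductSpace ℝ V] [FiniteDimensional ℝ V]
  [MeasurableSpace V] [BorelSpace V]

/-- If `v = div P` in the interior of `K`, then `f(w) ζ` is an admissible test function, where
`w` has the weak gradient `g`. -/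
theorem integral_test_comp {w v : V → ℝ} {g P : V → V} {K : Set V}
    (hw : MemLp w 2 volume) (hg : MemLp g 2 volume) (hv : MemLp v 2 volume)
    (hP : MemLp P 2 volume)
    (hwg : ∀ φ : V → ℝ, ContDiff ℝ ∞ φ → HasCompactSupport φ → tsupport φ ⊆ K →
      ∫ x, w x • gradient φ x = -∫ x, φ x • g x)
    (hvP : ∀ φ : V → ℝ, ContDiff ℝ ∞ φ → HasCompactSupport φ → tsupport φ ⊆ K →
      (∫ x, v x * φ x) + ∫ x, inner ℝ (P x) (gradient φ x) = 0)
    {f : ℝ → ℝ} {c c' : ℝ} (hf : ContDiff ℝ ∞ f) (hfc : ∀ a, |f a| ≤ c)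
    (hfc' : ∀ a, |deriv f a| ≤ c') {ζ : V → ℝ} (hζ : ContDiff ℝ ∞ ζ) (hζc : HasCompactSupport ζ)
    (hζK : tsupport ζ ⊆ interior K) :
    (∫ x, v x * (f (w x) * ζ x)) +
      ∫ x, inner ℝ (P x) ((deriv f (w x) * ζ x) • g x + f (w x) • gradient ζ x) = 0 := by
  have hwl : LocallyIntegrable w volume := hw.locallyIntegrable (by norm_num)
  have hgl : LocallyIntegrable g volume := hg.locallyIntegrable (by norm_num)
  have hfd : Continuous (deriv f) := hf.continuous_deriv (by simp)
  obtain ⟨Z, hZ⟩ : ∃ Z, ∀ x, ‖ζ x‖ ≤ Z := hζc.exists_bound_of_continuous hζ.continuous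
  have hc0 : 0 ≤ c := (abs_nonneg _).trans (hfc 0)
  have hc0' : 0 ≤ c' := (abs_nonneg _).trans (hfc' 0)
  have hZ0 : 0 ≤ Z := (norm_nonneg _).trans (hZ 0)
  have hgc := continuous_gradient hζ
  have hcζ := hasCompactSupport_gradient hζc
  have hζ2 : MemLp ζ 2 volume := hζ.continuous.memLp_of_hasCompactSupport hζc
  have hgζ2 : MemLp (gradient ζ) 2 volume :=
    hgc.memLp_of_hasCompactSupport hcζ
  -- The support of `ζ` has positive distance from the complement of `interior K`, so for large `n`
  -- the mollified weak gradient is the gradient of the mollification on all of `tsupport ζ`.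
  obtain ⟨δ, hδ, hδK⟩ := hζc.isCompact.exists_cthickening_subset_open isOpen_interior hζK
  have hball : ∀ᶠ n in atTop, ∀ x ∈ tsupport ζ, Metric.closedBall x (bump V n).rOut ⊆ K := by
    filter_upwards [(tendsto_bump_rOut (V := V)).eventually (ge_mem_nhds hδ)] with n hn x hx
    refine (Metric.closedBall_subset_closedBall hn).trans ?_
    exact (Metric.closedBall_subset_cthickening hx δ).trans (hδK.trans interior_subset)
  have hms : ∀ n, ContDiff ℝ ∞ (moll n w) := contDiff_moll hwl
  have hmg : ∀ n, Continuous (moll n g) := fun n => (contDiff_moll hgl n).continuous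
  obtain ⟨hm1, hm2⟩ := tendsto_eLpNorm_moll_sub hg
  have hPn : ∀ n, AEStronglyMeasurable (fun x => (deriv f (moll n w x) * ζ x) • P x) volume :=
    fun n => ((hfd.comp (hms n).continuous).mul hζ.continuous).aestronglyMeasurable.smul hP.1
  have hPb : ∀ a x, ‖(deriv f a * ζ x) • P x‖ ≤ c' * Z * ‖P x‖ := fun a x => by
    rw [norm_smul, norm_mul]
    gcongr
    · exact hfc' _
    · exact hZ x
  have hPL : ∀ n, MemLp (fun x => (deriv f (moll n w x) * ζ x) • P x) 2 volume := fun n =>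
    hP.of_le_mul (hPn n) (ae_of_all _ fun x => hPb _ x)
  have hi1 := (integrable_inner_of_memLp hv hζ2).norm.const_mul c
  have hi2 := (hP.norm.integrable_mul hgζ2.norm).const_mul c
  have hi3 := (hP.norm.integrable_mul hg.norm).const_mul (c' * Z)
  have hlim := ae_tendsto_moll hwl
  -- `moll n w` converges a.e. and enters only through the bounded functions `f` and `deriv f`, so
  -- dominated convergence covers `T1`, `T2` and `T3`.
  have T1 : Tendsto (fun n => ∫ x, v x * (f (moll n w x) * ζ x)) atTop
      (𝓝 (∫ x, v x * (f (w x) * ζ x))) := by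
    refine tendsto_integral_of_dominated_convergence _ (fun n => ?_) hi1 (fun n => ?_) ?_
    · exact hv.1.mul ((hf.continuous.comp (hms n).continuous).mul
        hζ.continuous).aestronglyMeasurable
    · refine ae_of_all _ fun x => ?_
      have : ‖inner ℝ (v x) (ζ x)‖ = ‖v x‖ * ‖ζ x‖ := by simp [mul_comm]
      rw [this, norm_mul, norm_mul]
      nlinarith [hfc (moll n w x), Real.norm_eq_abs (f (moll n w x)),
        mul_nonneg (norm_nonneg (v x)) (norm_nonneg (ζ x))]
    · filter_upwards [hlim] with x hx
      exact (((hf.continuous.tendsto _).comp hx).mul_const _).const_mul _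
  have T2 : Tendsto (fun n => ∫ x, f (moll n w x) * inner ℝ (P x) (gradient ζ x)) atTop
      (𝓝 (∫ x, f (w x) * inner ℝ (P x) (gradient ζ x))) := by
    refine tendsto_integral_of_dominated_convergence _ (fun n => ?_) hi2 (fun n => ?_) ?_
    · exact (hf.continuous.comp (hms n).continuous).aestronglyMeasurable.mul (hP.1.inner hgζ2.1)
    · refine ae_of_all _ fun x => ?_
      rw [norm_mul]
      exact mul_le_mul (hfc _) (norm_inner_le_norm _ _) (norm_nonneg _) hc0
    · filter_upwards [hlim] with x hx
      exact ((hf.continuous.tendsto _).comp hx).mul_const _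
  have T3 : Tendsto (fun n => ∫ x, inner ℝ ((deriv f (moll n w x) * ζ x) • P x) (g x)) atTop
      (𝓝 (∫ x, inner ℝ ((deriv f (w x) * ζ x) • P x) (g x))) := by
    refine tendsto_integral_of_dominated_convergence _ (fun n => ?_) hi3 (fun n => ?_) ?_
    · exact (hPn n).inner hg.1
    · refine ae_of_all _ fun x => ?_
      refine (norm_inner_le_norm _ _).trans ?_
      simp only [Pi.mul_apply, ← mul_assoc]
      gcongr
      exact hPb _ _
    · filter_upwards [hlim] with x hx
      exact ((((hfd.tendsto _).comp hx).mul_const _).smul_const _).inner tendsto_const_nhds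
  -- The gradients `moll n g` converge only in L²; their deviation from `g` is split off and paired
  -- with a dominated factor.
  have T4 := tendsto_integral_inner_zero hP hPn (fun n => ae_of_all _ fun x => hPb _ x)
    (b := fun n x => moll n g x - g x) (hm1.mono fun n hn => hn.sub hg) hm2
  have hzero : ∀ᶠ n in atTop, (∫ x, v x * (f (moll n w x) * ζ x)) +
      ((∫ x, inner ℝ ((deriv f (moll n w x) * ζ x) • P x) (moll n g x - g x)) +
        (∫ x, inner ℝ ((deriv f (moll n w x) * ζ x) • P x) (g x)) +
        ∫ x, f (moll n w x) * inner ℝ (P x) (gradient ζ x)) = 0 := by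
    filter_upwards [hball, hm1] with n hn hmn
    have hφs : ContDiff ℝ ∞ fun x => f (moll n w x) * ζ x := (hf.comp (hms n)).mul hζ
    have h1 := hvP (fun x => f (moll n w x) * ζ x) hφs hζc.mul_left
      ((tsupport_mul_subset_right).trans (hζK.trans interior_subset))
    have hI2 : Integrable (fun x => f (moll n w x) * inner ℝ (P x) (gradient ζ x)) volume := by
      refine hi2.mono' ((hf.continuous.comp (hms n).continuous).aestronglyMeasurable.mul
        (hP.1.inner hgζ2.1)) (ae_of_all _ fun x => ?_)
      rw [norm_mul]
      exact mul_le_mul (hfc _) (norm_inner_le_norm _ _) (norm_nonneg _) hc0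
    have hI3 : Integrable (fun x => inner ℝ ((deriv f (moll n w x) * ζ x) • P x)
        (moll n g x - g x)) volume := integrable_inner_of_memLp (hPL n) (hmn.sub hg)
    have hI4 := integrable_inner_of_memLp (hPL n) hg
    rw [← h1, ← integral_add hI3 hI4, ← integral_add (by exact hI3.add hI4) hI2]
    congr 1
    refine integral_congr_ae (ae_of_all _ fun x => ?_)
    beta_reduce
    rw [gradient_mul_comp (hf.differentiable (by simp))
      ((hms n).differentiable (by simp)).differentiableAt
      (hζ.differentiable (by simp)).differentiableAt]
    by_cases hx : x ∈ tsupport ζ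
    · rw [fderiv_moll hwl hgl hwg (hn x hx)]
      simp only [inner_add_right, inner_smul_right, inner_smul_left, inner_sub_right,
        RCLike.conj_to_real]
      ring
    · rw [image_eq_zero_of_notMem_tsupport hx]
      simp [inner_smul_right]
  have hT := T1.add ((T4.add T3).add T2)
  have h0 := tendsto_nhds_unique (hT.congr' hzero) tendsto_const_nhds
  have hfw : AEStronglyMeasurable (fun x => f (w x)) volume :=
    hf.continuous.comp_aestronglyMeasurable hw.1
  have hJ1 : Integrable (fun x => inner ℝ ((deriv f (w x) * ζ x) • P x) (g x)) volume := by
    refine integrable_inner_of_memLp (hP.of_le_mul (c := c' * Z) ?_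
      (ae_of_all _ fun x => hPb _ x)) hg
    exact ((hfd.comp_aestronglyMeasurable hw.1).mul hζ.continuous.aestronglyMeasurable).smul hP.1
  have hJ2 : Integrable (fun x => f (w x) * inner ℝ (P x) (gradient ζ x)) volume := by
    refine hi2.mono' (hfw.mul (hP.1.inner hgζ2.1)) (ae_of_all _ fun x => ?_)
    rw [norm_mul]
    exact mul_le_mul (hfc _) (norm_inner_le_norm _ _) (norm_nonneg _) hc0
  rw [zero_add, ← integral_add hJ1 hJ2] at h0
  rw [← h0]
  congr 1
  refine integral_congr_ae (ae_of_all _ fun x => ?_)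
  simp only [inner_add_right, inner_smul_right, inner_smul_left, RCLike.conj_to_real]

end Slice

/-! ### The convex primitive of `f ∘ log` -/

section Primitive

/-- The primitive of `f ∘ log` that vanishes at `0`. -/
noncomputable def logPrimitive (f : ℝ → ℝ) (a : ℝ) : ℝ := ∫ v in (0 : ℝ)..a, f (Real.log v)

variable {f : ℝ → ℝ} {c : ℝ}

theorem intervalIntegrable_comp_log (hf : Continuous f) (hfc : ∀ a, |f a| ≤ c) (a b : ℝ) :
    IntervalIntegrable (fun v => f (Real.log v)) volume a b := by
  refine (intervalIntegrable_const (c := c)).mono_fun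
    (hf.measurable.comp Real.measurable_log).aestronglyMeasurable (ae_of_all _ fun v => ?_)
  exact (hfc _).trans (le_abs_self c)

/-- Linear growth is what lets the mass control the time terms of the energy inequality. -/
theorem abs_logPrimitive_le (hfc : ∀ a, |f a| ≤ c) (a : ℝ) : |logPrimitive f a| ≤ c * |a| := by
  have := intervalIntegral.norm_integral_le_of_norm_le_const (a := 0) (b := a)
    (f := fun v => f (Real.log v)) (C := c) fun v _ => hfc _
  simpa [logPrimitive] using this

theorem continuous_logPrimitive (hf : Continuous f) (hfc : ∀ a, |f a| ≤ c) :
    Continuous (logPrimitive f) :=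
  intervalIntegral.continuous_primitive (fun a b => intervalIntegrable_comp_log hf hfc a b) 0

/-- The derivative `f ∘ log` is increasing on `(0, ∞)`, so the primitive is convex there and this is
its tangent inequality at `a`. It is the one-sided substitute for the chain rule in time. -/
theorem logPrimitive_sub_le (hf : Continuous f) (hfc : ∀ a, |f a| ≤ c) (hmono : Monotone f)
    {a b : ℝ} (ha : 0 < a) (hb : 0 < b) :
    logPrimitive f a - logPrimitive f b ≤ (a - b) * f (Real.log a) := by
  have hi := intervalIntegrable_comp_log hf hfc
  rw [logPrimitive, logPrimitive, intervalIntegral.integral_interval_sub_left (hi _ _) (hi _ _)]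
  rcases le_total b a with h | h
  · have := intervalIntegral.integral_mono_on h (hi b a)
      (intervalIntegrable_const (c := f (Real.log a)))
      fun v hv => hmono (Real.log_le_log (hb.trans_le hv.1) hv.2)
    simpa using this
  · have := intervalIntegral.integral_mono_on h (intervalIntegrable_const (c := f (Real.log a)))
      (hi a b) fun v hv => hmono (Real.log_le_log ha hv.1)
    rw [intervalIntegral.integral_symm]
    simp only [intervalIntegral.integral_const, smul_eq_mul] at this
    linarith

end Primitive

/-! ### Slices of L² functions on a product -/

section Sections

variable {α β F : Type*} [MeasurableSpace α] [MeasurableSpace β] {μ : Measure α} {ν : Measure β}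
  [SFinite ν] [NormedAddCommGroup F]

theorem memLp_two_prodMk_left {g : α × β → F} (hg : MemLp g 2 (μ.prod ν)) :
    ∀ᵐ x ∂μ, MemLp (fun y => g (x, y)) 2 ν := by
  have h1 := eLpNorm_two_sq (μ.prod ν) g
  rw [lintegral_prod _ (by exact hg.1.enorm.pow_const 2)] at h1
  have h2 : ∀ᵐ x ∂μ, ∫⁻ y, ‖g (x, y)‖ₑ ^ 2 ∂ν < ⊤ := by
    refine ae_lt_top' (hg.1.enorm.pow_const 2).lintegral_prod_right' ?_
    rw [← h1]
    exact (ENNReal.pow_lt_top hg.2).ne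
  filter_upwards [h2, hg.1.prodMk_left] with x hx hm
  refine ⟨hm, ?_⟩
  rw [← eLpNorm_two_sq ν (fun y => g (x, y))] at hx
  exact (ENNReal.pow_lt_top_iff.1 hx).resolve_right (by norm_num)

theorem memLp_two_prodMk_right [SFinite μ] {g : α × β → F} (hg : MemLp g 2 (μ.prod ν)) :
    ∀ᵐ y ∂ν, MemLp (fun x => g (x, y)) 2 μ :=
  memLp_two_prodMk_left
    (hg.comp_measurePreserving (Measure.measurePreserving_swap (μ := ν) (ν := μ)))

end Sections

/-! ### The energy inequality for backward time differences -/

section Energy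

variable {V : Type*} [NormedAddCommGroup V] [InnerProductSpace ℝ V] [FiniteDimensional ℝ V]
  [MeasurableSpace V] [BorelSpace V]

/-- `u_t = div F` weakly in the interior of `K`, over the time interval `[s, t]`, where `u > 0` and
`w = log u` has the weak gradient `G`. All functions are defined globally and are globally square
integrable (they may be cut off outside the cylinder). -/
structure WeakData (K : Set V) (s t : ℝ) (u w : V × ℝ → ℝ) (F G : V × ℝ → V) : Prop where
  memLp_u : MemLp u 2 (volume.prod volume)
  memLp_w : MemLp w 2 (volume.prod volume)
  memLp_F : MemLp F 2 (volume.prod volume)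
  memLp_G : MemLp G 2 (volume.prod volume)
  grad : ∀ᵐ τ ∂(volume.restrict (Ioc s t)), ∀ φ : V → ℝ, ContDiff ℝ ∞ φ → HasCompactSupport φ →
    tsupport φ ⊆ K → ∫ x, w (x, τ) • gradient φ x = -∫ x, φ x • G (x, τ)
  eqn : ∀ φ : V → ℝ, ContDiff ℝ ∞ φ → HasCompactSupport φ → tsupport φ ⊆ K →
    ∀ t₁ t₂ : ℝ, s ≤ t₁ → t₁ < t₂ → t₂ ≤ t →
      (∫ x, u (x, t₂) * φ x) - (∫ x, u (x, t₁) * φ x) +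
        ∫ z, inner ℝ (F z) (gradient φ z.1) ∂(volume.prod (volume.restrict (Ioc t₁ t₂))) = 0
  pos : ∀ᵐ z ∂((volume.restrict K).prod (volume.restrict (Ioc s t))),
    0 < u z ∧ w z = Real.log (u z)

/-- The spatial gradient of the test function `f(w) ζ`. -/
noncomputable def testGrad (f : ℝ → ℝ) (ζ : V → ℝ) (w : V × ℝ → ℝ) (G : V × ℝ → V)
    (z : V × ℝ) : V :=
  (deriv f (w z) * ζ z.1) • G z + f (w z) • gradient ζ z.1

theorem ae_slab_mono {α : Type*} [MeasurableSpace α] {μ : Measure α} [SFinite μ]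
    {p : α × ℝ → Prop} {A B : Set ℝ} (hAB : A ⊆ B)
    (h : ∀ᵐ z ∂(μ.prod (volume.restrict B)), p z) : ∀ᵐ z ∂(μ.prod (volume.restrict A)), p z :=
  (Measure.AbsolutelyContinuous.prod Measure.AbsolutelyContinuous.rfl
    (Measure.restrict_mono hAB le_rfl).absolutelyContinuous).ae_le h

theorem memLp_slab {α F : Type*} [MeasurableSpace α] {μ : Measure α} [SFinite μ]
    [NormedAddCommGroup F] {g : α × ℝ → F} {p : ℝ≥0∞} (hg : MemLp g p (μ.prod volume))
    (A : Set ℝ) : MemLp g p (μ.prod (volume.restrict A)) := by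
  have : μ.prod (volume.restrict A) = (μ.prod volume).restrict (univ ×ˢ A) := by
    rw [← Measure.prod_restrict, Measure.restrict_univ]
  rw [this]
  exact hg.restrict _

theorem ae_shift {p : ℝ → Prop} {s t h : ℝ} (hh : 0 < h)
    (hp : ∀ᵐ τ ∂(volume.restrict (Ioc s t)), p τ) :
    ∀ᵐ τ ∂(volume.restrict (Ioc (s + h) t)), p (τ - h) := by
  rw [ae_restrict_iff' measurableSet_Ioc] at hp ⊢
  filter_upwards [(measurePreserving_sub_right volume h).quasiMeasurePreserving.ae hp] with τ hτ hm
  exact hτ ⟨by linarith [hm.1], by linarith [hm.2]⟩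

theorem memLp_testGrad {s t c c' : ℝ} {f : ℝ → ℝ} {ζ : V → ℝ} {w : V × ℝ → ℝ} {G : V × ℝ → V}
    (hw : AEStronglyMeasurable w (volume.prod (volume.restrict (Ioc s t))))
    (hG : MemLp G 2 (volume.prod (volume.restrict (Ioc s t))))
    (hf : ContDiff ℝ ∞ f) (hfc : ∀ a, |f a| ≤ c)
    (hfc' : ∀ a, |deriv f a| ≤ c') (hζ : ContDiff ℝ ∞ ζ) (hζc : HasCompactSupport ζ) :
    MemLp (testGrad f ζ w G) 2 (volume.prod (volume.restrict (Ioc s t))) := by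
  obtain ⟨Z, hZ⟩ : ∃ Z, ∀ x, ‖ζ x‖ ≤ Z := hζc.exists_bound_of_continuous hζ.continuous
  have hfd : Continuous (deriv f) := hf.continuous_deriv (by simp)
  have hgc := continuous_gradient hζ
  have hcζ := hasCompactSupport_gradient hζc
  have hgζ2 : MemLp (fun z : V × ℝ => gradient ζ z.1) 2
      (volume.prod (volume.restrict (Ioc s t))) :=
    (hgc.memLp_of_hasCompactSupport hcζ).comp_fst _
  have hc0' : 0 ≤ c' := (abs_nonneg _).trans (hfc' 0)
  refine MemLp.add (f := fun z : V × ℝ => (deriv f (w z) * ζ z.1) • G z)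
    (g := fun z : V × ℝ => f (w z) • gradient ζ z.1) ?_ ?_
  · refine hG.of_le_mul (c := c' * Z) ?_ (ae_of_all _ fun z => ?_)
    · exact ((hfd.comp_aestronglyMeasurable hw).mul
        (hζ.continuous.comp continuous_fst).aestronglyMeasurable).smul hG.1
    · rw [norm_smul, norm_mul]
      gcongr
      · exact hfc' _
      · exact hZ _
  · refine hgζ2.of_le_mul (c := c) ?_ (ae_of_all _ fun z => ?_)
    · exact (hf.continuous.comp_aestronglyMeasurable hw).smul hgζ2.1
    · rw [norm_smul]
      gcongr
      exact hfc _

namespace WeakData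

variable {K : Set V} {s t : ℝ} {u w : V × ℝ → ℝ} {F G : V × ℝ → V} {f : ℝ → ℝ} {c c' S : ℝ}
  {ζ : V → ℝ}

/-- Fubini turns the equation between two times into `u(t₂) - u(t₁) = div P` in `K` with `P = ∫ F
dσ`. Time is now a parameter, so `integral_test_comp` applies without any `u_t`. -/
theorem eqn_slice (D : WeakData K s t u w F G) {t₁ t₂ : ℝ} (h₁ : s ≤ t₁) (h₁₂ : t₁ < t₂)
    (h₂ : t₂ ≤ t) (hu₁ : MemLp (fun x => u (x, t₁)) 2 volume)
    (hu₂ : MemLp (fun x => u (x, t₂)) 2 volume) {φ : V → ℝ} (hφ : ContDiff ℝ ∞ φ)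
    (hφc : HasCompactSupport φ) (hφK : tsupport φ ⊆ K) :
    (∫ x, (u (x, t₂) - u (x, t₁)) * φ x) +
      ∫ x, inner ℝ (∫ σ in t₁..t₂, F (x, σ)) (gradient φ x) = 0 := by
  have hφ2 : MemLp φ 2 volume := hφ.continuous.memLp_of_hasCompactSupport hφc
  have hgc := continuous_gradient hφ
  have hcφ := hasCompactSupport_gradient hφc
  have hgφ2 : MemLp (gradient φ) 2 volume := hgc.memLp_of_hasCompactSupport hcφ
  have hF := memLp_slab D.memLp_F (Ioc t₁ t₂)
  rw [← D.eqn φ hφ hφc hφK t₁ t₂ h₁ h₁₂ h₂]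
  have hi1 : Integrable (fun x => u (x, t₂) * φ x) volume := hu₂.integrable_mul hφ2
  have hi2 : Integrable (fun x => u (x, t₁) * φ x) volume := hu₁.integrable_mul hφ2
  rw [← integral_sub hi1 hi2, integral_prod _ (integrable_inner_of_memLp hF (hgφ2.comp_fst _))]
  congr 1
  · exact integral_congr_ae (ae_of_all _ fun x => sub_mul _ _ _)
  · refine integral_congr_ae ?_
    filter_upwards [memLp_two_prodMk_left hF] with x hx
    have hxi : Integrable (fun σ => F (x, σ)) (volume.restrict (Ioc t₁ t₂)) :=
      hx.integrable (by norm_num)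
    rw [intervalIntegral.integral_of_le h₁₂.le, real_inner_comm, ← integral_inner hxi]
    exact integral_congr_ae (ae_of_all _ fun σ => real_inner_comm _ _)

/-- The energy inequality for the backward Steklov averages. -/
theorem steklov_energy_le (D : WeakData K s t u w F G) (hK : MeasurableSet K)
    (hf : ContDiff ℝ ∞ f) (hmono : Monotone f) (hfc : ∀ a, |f a| ≤ c)
    (hfc' : ∀ a, |deriv f a| ≤ c') (hζ : ContDiff ℝ ∞ ζ) (hζc : HasCompactSupport ζ)
    (hζK : tsupport ζ ⊆ interior K) (hζ0 : ∀ x, 0 ≤ ζ x)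
    (hS : ∀ᵐ τ ∂(volume.restrict (Ioc s t)), ∫ x, u (x, τ) * ζ x ≤ S)
    {h : ℝ} (hh : 0 < h) (hht : s + h ≤ t)
    (hP : MemLp (fun z : V × ℝ => ∫ σ in z.2 - h..z.2, F (z.1, σ)) 2 (volume.prod volume)) :
    ∫ z, inner ℝ (∫ σ in z.2 - h..z.2, F (z.1, σ)) (testGrad f ζ w G z)
      ∂(volume.prod (volume.restrict (Ioc (s + h) t))) ≤ 2 * (c * S) * h := by
  have hc0 : 0 ≤ c := (abs_nonneg _).trans (hfc 0)
  have hsub : Ioc (s + h) t ⊆ Ioc s t := Ioc_subset_Ioc_left (by linarith)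
  have hζ2 : MemLp ζ 2 volume := hζ.continuous.memLp_of_hasCompactSupport hζc
  have hΨ := continuous_logPrimitive hf.continuous hfc
  set Ψ := logPrimitive f with hΨdef
  have hpos : ∀ᵐ τ ∂(volume.restrict (Ioc s t)), ∀ᵐ x ∂(volume.restrict K),
      0 < u (x, τ) ∧ w (x, τ) = Real.log (u (x, τ)) :=
    Measure.ae_ae_of_ae_prod (Measure.measurePreserving_swap.quasiMeasurePreserving.ae D.pos)
  have hζout : ∀ x ∉ K, ζ x = 0 := fun x hx =>
    image_eq_zero_of_notMem_tsupport fun h => hx (interior_subset (hζK h))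
  have hΨu : MemLp (fun z => Ψ (u z)) 2 (volume.prod (volume.restrict (Ioc s t))) :=
    (memLp_slab D.memLp_u _).of_le_mul (c := c)
      (hΨ.comp_aestronglyMeasurable (memLp_slab D.memLp_u _).1)
      (ae_of_all _ fun z => abs_logPrimitive_le hfc _)
  have hm : IntegrableOn (fun τ => ∫ x, Ψ (u (x, τ)) * ζ x) (Ioc s t) volume :=
    Integrable.integral_prod_right
      (f := fun z : V × ℝ => Ψ (u z) * ζ z.1) (hΨu.integrable_mul (hζ2.comp_fst _))
  set m : ℝ → ℝ := fun τ => ∫ x, Ψ (u (x, τ)) * ζ x with hmdef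
  have husl := memLp_two_prodMk_right (memLp_slab D.memLp_u (Ioc s t))
  have hmle : ∀ᵐ τ ∂(volume.restrict (Ioc s t)), |m τ| ≤ c * S := by
    filter_upwards [hpos, hS, husl] with τ h1 h2 h3
    have hi : Integrable (fun x => u (x, τ) * ζ x) volume := h3.integrable_mul hζ2
    refine le_trans ?_ (mul_le_mul_of_nonneg_left h2 hc0)
    rw [← integral_const_mul]
    rw [← Real.norm_eq_abs]
    refine norm_integral_le_of_norm_le (hi.const_mul c) ?_
    rw [ae_restrict_iff' hK] at h1
    filter_upwards [h1] with x hx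
    by_cases hxK : x ∈ K
    · have := abs_logPrimitive_le hfc (u (x, τ))
      rw [abs_of_pos (hx hxK).1] at this
      rw [norm_mul, Real.norm_of_nonneg (hζ0 x), ← mul_assoc]
      exact mul_le_mul_of_nonneg_right this (hζ0 x)
    · simp [hζout x hxK]
  have hslice : ∀ᵐ τ ∂(volume.restrict (Ioc (s + h) t)),
      ∫ x, inner ℝ (∫ σ in τ - h..τ, F (x, σ)) (testGrad f ζ w G (x, τ)) ≤ m (τ - h) - m τ := by
    filter_upwards [ae_restrict_of_ae_restrict_of_subset hsub hpos, ae_shift hh hpos,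
      ae_restrict_of_ae_restrict_of_subset hsub husl, ae_shift hh husl,
      ae_restrict_of_ae_restrict_of_subset hsub D.grad,
      ae_restrict_of_ae (memLp_two_prodMk_right D.memLp_w),
      ae_restrict_of_ae (memLp_two_prodMk_right D.memLp_G),
      ae_restrict_of_ae (memLp_two_prodMk_right hP),
      ae_restrict_of_ae_restrict_of_subset hsub (memLp_two_prodMk_right hΨu),
      ae_shift hh (memLp_two_prodMk_right hΨu),
      ae_restrict_mem measurableSet_Ioc] with τ p1 p2 u1 u2 gr w1 G1 P1 Ψ1 Ψ2 hτ
    have key := integral_test_comp w1 G1 (u1.sub u2) P1 gr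
      (fun φ a1 a2 a3 => D.eqn_slice (by linarith [hτ.1]) (by linarith) hτ.2 u2 u1 a1 a2 a3)
      hf hfc hfc' hζ hζc hζK
    have hi1 : Integrable (fun x => Ψ (u (x, τ)) * ζ x) volume := Ψ1.integrable_mul hζ2
    have hi2 : Integrable (fun x => Ψ (u (x, τ - h)) * ζ x) volume := Ψ2.integrable_mul hζ2
    -- The test function is taken at the later time `τ`, which is the base point of the tangent
    -- inequality; this is why the differences are backward.
    have hconv : m τ - m (τ - h) ≤
        ∫ x, (u (x, τ) - u (x, τ - h)) * (f (w (x, τ)) * ζ x) := by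
      rw [hmdef]
      beta_reduce
      rw [← integral_sub hi1 hi2]
      refine integral_mono_ae (hi1.sub hi2) ?_ ?_
      · have hfζ : MemLp (fun x => f (w (x, τ)) * ζ x) 2 volume := by
          refine hζ2.of_le_mul (c := c) ((hf.continuous.comp_aestronglyMeasurable w1.1).mul hζ2.1)
            (ae_of_all _ fun x => ?_)
          rw [norm_mul]
          gcongr
          exact hfc _
        exact (u1.sub u2).integrable_mul hfζ
      · rw [ae_restrict_iff' hK] at p1 p2
        filter_upwards [p1, p2] with x q1 q2
        by_cases hxK : x ∈ K
        · have := logPrimitive_sub_le hf.continuous hfc hmono (q1 hxK).1 (q2 hxK).1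
          rw [← (q1 hxK).2] at this
          nlinarith [hζ0 x]
        · simp [hζout x hxK]
    have key' : (∫ x, (u (x, τ) - u (x, τ - h)) * (f (w (x, τ)) * ζ x)) +
      ∫ x, inner ℝ (∫ σ in τ - h..τ, F (x, σ)) (testGrad f ζ w G (x, τ)) = 0 := key
    linarith
  have hΦ := memLp_testGrad (memLp_slab D.memLp_w (Ioc (s + h) t)).1
    (memLp_slab D.memLp_G _) hf hfc hfc' hζ hζc
  have hint := integrable_inner_of_memLp (memLp_slab hP _) hΦ
  rw [integral_prod_symm _ hint]
  have hmI : ∀ a b, s ≤ a → a ≤ b → b ≤ t → IntervalIntegrable m volume a b := fun a b ha hab hb =>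
    (intervalIntegrable_iff_integrableOn_Ioc_of_le hab).2 (hm.mono_set (Ioc_subset_Ioc ha hb))
  have hmsh : IntervalIntegrable (fun τ => m (τ - h)) volume (s + h) t := by
    have := (hmI s (t - h) le_rfl (by linarith) (by linarith)).comp_sub_right h
    simpa using this
  have hms := hmI (s + h) t (by linarith) hht le_rfl
  have hbd : ∀ a b, s ≤ a → a ≤ b → b ≤ t → |∫ τ in a..b, m τ| ≤ c * S * (b - a) := by
    intro a b ha hab hb
    rw [← abs_of_nonneg (sub_nonneg.2 hab), ← Real.norm_eq_abs (∫ τ in a..b, m τ)]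
    refine intervalIntegral.norm_integral_le_of_norm_le_const_ae ?_
    rw [uIoc_of_le hab]
    rw [ae_restrict_iff' measurableSet_Ioc] at hmle
    filter_upwards [hmle] with τ h1 h2
    exact h1 ⟨by linarith [h2.1], h2.2.trans hb⟩
  calc ∫ τ in Ioc (s + h) t, ∫ x, inner ℝ (∫ σ in τ - h..τ, F (x, σ)) (testGrad f ζ w G (x, τ))
      ≤ ∫ τ in Ioc (s + h) t, (m (τ - h) - m τ) := by
        refine integral_mono_ae hint.integral_prod_right ?_ hslice
        exact ((intervalIntegrable_iff_integrableOn_Ioc_of_le hht).1 (hmsh.sub hms))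
    -- Each of the two integrals is the integral of `m` over `(s, t)` minus one end strip of length
    -- `h`. Only the strips survive, each at most `c * S * h` in absolute value.
    _ = (∫ τ in s..(s + h), m τ) - ∫ τ in (t - h)..t, m τ := by
        rw [← intervalIntegral.integral_of_le hht, intervalIntegral.integral_sub hmsh hms,
          intervalIntegral.integral_comp_sub_right m h, add_sub_cancel_right]
        have e1 := intervalIntegral.integral_add_adjacent_intervals
          (hmI s (s + h) le_rfl (by linarith) hht) hms
        have e2 := intervalIntegral.integral_add_adjacent_intervals
          (hmI s (t - h) le_rfl (by linarith) (by linarith))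
          (hmI (t - h) t (by linarith) (by linarith) le_rfl)
        linarith
    _ ≤ 2 * (c * S) * h := by
        have b1 := abs_le.1 (hbd s (s + h) le_rfl (by linarith) hht)
        have b2 := abs_le.1 (hbd (t - h) t (by linarith) (by linarith) le_rfl)
        nlinarith [b1.2, b2.1]

end WeakData

end Energy

/-! ### Removing the Steklov averages -/

section Steklov

variable {V : Type*} [NormedAddCommGroup V] [InnerProductSpace ℝ V] [FiniteDimensional ℝ V]
  [MeasurableSpace V] [BorelSpace V]

/-- The backward Steklov average is the average over translates by `(0, θ)` with `θ` uniform on `(0,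
h n]`, so `tendsto_average` applies on `V × ℝ`. -/
theorem tendsto_steklov {F : V × ℝ → V} (hF : MemLp F 2 (volume.prod volume)) {h : ℕ → ℝ}
    (hpos : ∀ n, 0 < h n) (hlim : Tendsto h atTop (𝓝 0)) :
    (∀ᶠ n in atTop, MemLp (fun z : V × ℝ => (h n)⁻¹ • ∫ σ in z.2 - h n..z.2, F (z.1, σ)) 2
      (volume.prod volume)) ∧
    Tendsto (fun n => eLpNorm (fun z : V × ℝ =>
      ((h n)⁻¹ • ∫ σ in z.2 - h n..z.2, F (z.1, σ)) - F z) 2 (volume.prod volume)) atTop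
      (𝓝 0) := by
  let κ : ℕ → Measure ℝ := fun n => (ENNReal.ofReal (h n))⁻¹ • volume.restrict (Ioc 0 (h n))
  have hp : ∀ n, IsProbabilityMeasure (κ n) := fun n => by
    refine ⟨?_⟩
    simp only [κ, Measure.smul_apply, Measure.restrict_apply MeasurableSet.univ, univ_inter,
      Real.volume_Ioc, sub_zero, smul_eq_mul]
    exact ENNReal.inv_mul_cancel (by simpa using hpos n) ENNReal.ofReal_ne_top
  have hsh : Measurable fun θ : ℝ => ((0 : V), θ) := by fun_prop
  have key := tendsto_average hF (κ := κ) hsh hlim (fun n => by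
    refine Measure.ae_smul_measure ?_ _
    filter_upwards [ae_restrict_mem measurableSet_Ioc] with θ hθ
    simp only [Prod.norm_def, norm_zero]
    exact max_le (hpos n).le (by rw [Real.norm_of_nonneg hθ.1.le]; exact hθ.2))
  have heq : ∀ n (z : V × ℝ), ∫ θ, F (z - ((0 : V), θ)) ∂(κ n) =
      (h n)⁻¹ • ∫ σ in z.2 - h n..z.2, F (z.1, σ) := fun n z => by
    have e := intervalIntegral.integral_comp_sub_left (a := 0) (b := h n)
      (fun σ => F (z.1, σ)) z.2
    rw [sub_zero] at e
    rw [← e, integral_smul_measure, ENNReal.toReal_inv, ENNReal.toReal_ofReal (hpos n).le,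
      intervalIntegral.integral_of_le (hpos n).le]
    congr 1
    refine integral_congr_ae (ae_of_all _ fun θ => ?_)
    simp [Prod.sub_def]
  simpa only [heq] using key

namespace WeakData

variable {K : Set V} {s t : ℝ} {u w : V × ℝ → ℝ} {F G : V × ℝ → V} {f : ℝ → ℝ} {c c' S : ℝ}
  {ζ : V → ℝ}

/-- The energy inequality, obtained with the test function `f(log u) ζ`. -/
theorem energy_le (D : WeakData K s t u w F G) (hK : MeasurableSet K) (hst : s < t)
    (hf : ContDiff ℝ ∞ f) (hmono : Monotone f) (hfc : ∀ a, |f a| ≤ c)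
    (hfc' : ∀ a, |deriv f a| ≤ c') (hζ : ContDiff ℝ ∞ ζ) (hζc : HasCompactSupport ζ)
    (hζK : tsupport ζ ⊆ interior K) (hζ0 : ∀ x, 0 ≤ ζ x)
    (hS : ∀ᵐ τ ∂(volume.restrict (Ioc s t)), ∫ x, u (x, τ) * ζ x ≤ S) :
    ∫ z, inner ℝ (F z) (testGrad f ζ w G z) ∂(volume.prod (volume.restrict (Ioc s t)))
      ≤ 2 * (c * S) := by
  set h : ℕ → ℝ := fun n => (t - s) * (1 / ((n : ℝ) + 1)) with hh
  have hpos : ∀ n, 0 < h n := fun n => mul_pos (sub_pos.2 hst) (by positivity)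
  have hle : ∀ n, s + h n ≤ t := fun n => by
    have h1 : (1 : ℝ) / ((n : ℝ) + 1) ≤ 1 := by
      rw [div_le_one (by positivity)]; linarith [Nat.cast_nonneg (α := ℝ) n]
    nlinarith [hh]
  have hlim : Tendsto h atTop (𝓝 0) := by
    have := (tendsto_one_div_add_atTop_nhds_zero_nat (𝕜 := ℝ)).const_mul (t - s)
    rwa [mul_zero] at this
  have hanti : Antitone h := fun m n hmn =>
    mul_le_mul_of_nonneg_left (one_div_le_one_div_of_le (by positivity) (by gcongr))
      (sub_pos.2 hst).le
  set μ := (volume : Measure V).prod (volume.restrict (Ioc s t)) with hμ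
  have hΦ : MemLp (testGrad f ζ w G) 2 μ := memLp_testGrad (memLp_slab D.memLp_w _).1
    (memLp_slab D.memLp_G _) hf hfc hfc' hζ hζc
  set Φ := testGrad f ζ w G with hΦdef
  set P : ℕ → V × ℝ → V := fun n z => (h n)⁻¹ • ∫ σ in z.2 - h n..z.2, F (z.1, σ) with hP
  obtain ⟨hP1, hP2⟩ := tendsto_steklov D.memLp_F hpos hlim
  -- The averaged inequality holds only for times beyond `s + h n`, where the backward window stays
  -- in `[s, t]`. These sets increase to the whole slab; the indicator of `A n` keeps the measure
  -- fixed while the Steklov error tends to zero.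
  set A : ℕ → Set (V × ℝ) := fun n => univ ×ˢ Ioc (s + h n) t with hA
  have hAm : ∀ n, MeasurableSet (A n) := fun n => MeasurableSet.univ.prod measurableSet_Ioc
  have hμA : ∀ n, μ.restrict (A n) = volume.prod (volume.restrict (Ioc (s + h n) t)) := fun n => by
    rw [hμ, hA, ← Measure.prod_restrict, Measure.restrict_univ,
      Measure.restrict_restrict measurableSet_Ioc,
      inter_eq_left.2 (Ioc_subset_Ioc_left (by linarith [hpos n]))]
  have hFΦ : Integrable (fun z => inner ℝ (F z) (Φ z)) μ :=
    integrable_inner_of_memLp (memLp_slab D.memLp_F _) hΦ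
  have hle' : μ ≤ (volume : Measure V).prod volume := by
    have : μ = ((volume : Measure V).prod volume).restrict (univ ×ˢ Ioc s t) := by
      rw [← Measure.prod_restrict, Measure.restrict_univ]
    rw [this]; exact Measure.restrict_le_self
  have L1 : Tendsto (fun n => ∫ z in A n, inner ℝ (F z) (Φ z) ∂μ) atTop
      (𝓝 (∫ z, inner ℝ (F z) (Φ z) ∂μ)) := by
    have h1 := tendsto_setIntegral_of_monotone (μ := μ) (f := fun z => inner ℝ (F z) (Φ z)) hAm
      (fun m n hmn => prod_mono_right (Ioc_subset_Ioc_left (by linarith [hanti hmn])))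
      hFΦ.integrableOn
    have h2 : ∫ z in ⋃ n, A n, inner ℝ (F z) (Φ z) ∂μ = ∫ z, inner ℝ (F z) (Φ z) ∂μ := by
      have hU : ⋃ n, A n = univ ×ˢ Ioc s t := by
        ext ⟨x, τ⟩
        simp only [hA, mem_iUnion, mem_prod, mem_univ, true_and, mem_Ioc]
        constructor
        · rintro ⟨n, h1, h2⟩
          exact ⟨by linarith [hpos n], h2⟩
        · rintro ⟨h1, h2⟩
          obtain ⟨n, hn⟩ := (hlim.eventually (gt_mem_nhds (sub_pos.2 h1))).exists
          exact ⟨n, by linarith, h2⟩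
      rw [hU, hμ, ← Measure.prod_restrict, Measure.restrict_univ,
        Measure.restrict_restrict measurableSet_Ioc, inter_self]
    rwa [h2] at h1
  have L2 : Tendsto (fun n => ∫ z, inner ℝ ((A n).indicator Φ z) (P n z - F z) ∂μ) atTop
      (𝓝 0) := by
    refine tendsto_integral_inner_zero hΦ (C := 1) (fun n => hΦ.1.indicator (hAm n))
      (fun n => ae_of_all _ fun z => ?_) ?_ ?_
    · rw [one_mul]; exact norm_indicator_le_norm_self _ _
    · filter_upwards [hP1] with n hn
      exact (hn.sub D.memLp_F).mono_measure hle'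
    · exact tendsto_of_tendsto_of_tendsto_of_le_of_le tendsto_const_nhds hP2
        (fun _ => zero_le) (fun n => eLpNorm_mono_measure _ hle')
  have hbound : ∀ᶠ n in atTop, (∫ z, inner ℝ ((A n).indicator Φ z) (P n z - F z) ∂μ) +
      ∫ z in A n, inner ℝ (F z) (Φ z) ∂μ ≤ 2 * (c * S) := by
    filter_upwards [hP1] with n hn
    have hst := D.steklov_energy_le hK hf hmono hfc hfc' hζ hζc hζK hζ0 hS (hpos n) (hle n) (by
      refine (hn.const_smul (h n)).ae_eq (ae_of_all _ fun z => ?_)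
      simp [(hpos n).ne'])
    have hPF : MemLp (fun z => P n z - F z) 2 μ := (hn.sub D.memLp_F).mono_measure hle'
    have hPμ : MemLp (P n) 2 μ := hn.mono_measure hle'
    have e1 : ∫ z, inner ℝ ((A n).indicator Φ z) (P n z - F z) ∂μ =
        ∫ z in A n, inner ℝ (Φ z) (P n z - F z) ∂μ := by
      rw [← integral_indicator (hAm n)]
      refine integral_congr_ae (ae_of_all _ fun z => ?_)
      by_cases hz : z ∈ A n <;> simp [hz]
    rw [e1, ← integral_add (integrable_inner_of_memLp hΦ hPF).integrableOn hFΦ.integrableOn, hμA]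
    have e2 : ∀ z, inner ℝ (Φ z) (P n z - F z) + inner ℝ (F z) (Φ z) =
        (h n)⁻¹ * inner ℝ (∫ σ in z.2 - h n..z.2, F (z.1, σ)) (Φ z) := fun z => by
      rw [inner_sub_right, real_inner_comm (F z), sub_add_cancel]
      simp only [hP, inner_smul_right, real_inner_comm]
    simp only [e2]
    rw [integral_const_mul, inv_mul_le_iff₀ (hpos n), mul_comm (h n)]
    exact hst
  have := le_of_tendsto (L2.add L1) hbound
  simpa using this

end WeakData
end Steklov

/-! ### Comparison of localized masses for weak solutions -/

section MassEstimate

theorem contDiff_arctan_sub (l : ℝ) : ContDiff ℝ ∞ fun a => Real.arctan (a - l) :=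
  Real.contDiff_arctan.comp (contDiff_id.sub contDiff_const)

theorem deriv_arctan_sub (l a : ℝ) :
    deriv (fun a => Real.arctan (a - l)) a = 1 / (1 + (a - l) ^ 2) := by
  simp

theorem abs_arctan_le_two (a : ℝ) : |Real.arctan a| ≤ 2 :=
  abs_le.2 ⟨by linarith [Real.neg_pi_div_two_lt_arctan a, Real.pi_le_four],
    by linarith [Real.arctan_lt_pi_div_two a, Real.pi_le_four]⟩

theorem abs_deriv_arctan_sub_le (l a : ℝ) : |deriv (fun a => Real.arctan (a - l)) a| ≤ 1 := by
  rw [deriv_arctan_sub, abs_of_nonneg (by positivity), div_le_one (by positivity)]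
  nlinarith [sq_nonneg (a - l)]

/-- The difference of the two sides is a square. It is used with `q = 1 + (w - l)²`, `g = |G| η`, `b
= |Dη|`. The coefficient `24` leaves half of the left side after the later losses `4` and `8`. -/
theorem weighted_young {Co C₁ g b q : ℝ} (hCo : 0 < Co) (hq : 0 < q) :
    24 * C₁ * (g * b) ≤ Co * (1 / q * g ^ 2) + 144 * C₁ ^ 2 / Co * (b ^ 2 * q) := by
  have h : Co * (1 / q * g ^ 2) + 144 * C₁ ^ 2 / Co * (b ^ 2 * q) - 24 * C₁ * (g * b) =
      (Co * g - 12 * C₁ * b * q) ^ 2 / (Co * q) := by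
    field_simp
    ring
  have : 0 ≤ (Co * g - 12 * C₁ * b * q) ^ 2 / (Co * q) := by positivity
  linarith

theorem gradient_sq {V : Type*} [NormedAddCommGroup V] [InnerProductSpace ℝ V] [CompleteSpace V]
    {η : V → ℝ} (hη : ContDiff ℝ ∞ η) (x : V) :
    gradient (fun x => η x * η x) x = (2 * η x) • gradient η x := by
  have hd : Differentiable ℝ η := hη.differentiable (by simp)
  have := gradient_mul_comp (f := id) (w := η) (ζ := η) (x := x) differentiable_id (hd x) (hd x)
  simp only [id, deriv_id, one_mul] at this
  rw [this, ← add_smul, two_mul]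

variable {V : Type*} [NormedAddCommGroup V] [InnerProductSpace ℝ V] [FiniteDimensional ℝ V]
  [MeasurableSpace V] [BorelSpace V]

namespace WeakData

variable {K : Set V} {s t : ℝ} {u w : V × ℝ → ℝ} {F G : V × ℝ → V} {Co C₁ B Y l : ℝ} {η : V → ℝ}

/-- Comparison of the localized masses at two times. -/
theorem mass_le (D : WeakData K s t u w F G) (hK : IsCompact K) (hst : s < t)
    (hCo : 0 < Co) (hC₁ : 0 < C₁)
    (hF : ∀ᵐ z ∂((volume.restrict K).prod (volume.restrict (Ioc s t))),
      Co * ‖G z‖ ^ 2 ≤ inner ℝ (F z) (G z) ∧ ‖F z‖ ≤ C₁ * ‖G z‖)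
    (hη : ContDiff ℝ ∞ η) (hηc : HasCompactSupport η) (hηK : tsupport η ⊆ interior K)
    (hη0 : ∀ x, 0 ≤ η x) (hB : ∀ x, ‖gradient η x‖ ≤ B)
    (hY : ∫ z, (1 + (w z - l) ^ 2) ∂((volume.restrict K).prod (volume.restrict (Ioc s t))) ≤ Y)
    {τ₁ τ₂ : ℝ} (h₁ : τ₁ ∈ Icc s t) (h₂ : τ₂ ∈ Icc s t) :
    ∫ x, u (x, τ₁) * (η x * η x) ≤
      5 / 3 * (∫ x, u (x, τ₂) * (η x * η x)) + 24 * C₁ ^ 2 / Co * (B ^ 2 * Y) := by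
  have hKm := hK.isClosed.measurableSet
  set ζ : V → ℝ := fun x => η x * η x with hζdef
  have hζ : ContDiff ℝ ∞ ζ := hη.mul hη
  have hζc : HasCompactSupport ζ := hηc.mul_left
  have hζη : tsupport ζ ⊆ tsupport η := tsupport_mul_subset_right
  have hgζ : ∀ x, gradient ζ x = (2 * η x) • gradient η x := gradient_sq hη
  set m : ℝ → ℝ := fun τ => ∫ x, u (x, τ) * ζ x with hm
  set μ := (volume : Measure V).prod (volume.restrict (Ioc s t)) with hμ
  have hμK : μ.restrict (K ×ˢ univ) = (volume.restrict K).prod (volume.restrict (Ioc s t)) := by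
    rw [hμ, ← Measure.prod_restrict, Measure.restrict_univ]
  have hKum : MeasurableSet (K ×ˢ (univ : Set ℝ)) := hKm.prod MeasurableSet.univ
  have hF' : ∀ᵐ z ∂μ, z.1 ∈ K → Co * ‖G z‖ ^ 2 ≤ inner ℝ (F z) (G z) ∧ ‖F z‖ ≤ C₁ * ‖G z‖ := by
    rw [← hμK, ae_restrict_iff' hKum] at hF
    filter_upwards [hF] with z hz h
    exact hz ⟨h, trivial⟩
  have hηout : ∀ x ∉ K, η x = 0 := fun x hx =>
    image_eq_zero_of_notMem_tsupport fun h => hx (interior_subset (hηK h))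
  have hGs : MemLp G 2 μ := memLp_slab D.memLp_G _
  have hFs : MemLp F 2 μ := memLp_slab D.memLp_F _
  have hws : MemLp w 2 μ := memLp_slab D.memLp_w _
  have hgη := continuous_gradient hη
  have hgηc := hasCompactSupport_gradient hηc
  -- Since `Dζ = 2 η Dη` and `|F| ≤ C₁ |G|`, every flux term against `Dζ` is at most `2 * C₁ * k`.
  set k : V × ℝ → ℝ := fun z => ‖G z‖ * (η z.1 * ‖gradient η z.1‖) with hk
  have hk0 : ∀ z, 0 ≤ k z := fun z =>
    mul_nonneg (norm_nonneg _) (mul_nonneg (hη0 _) (norm_nonneg _))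
  have hki : Integrable k μ := by
    have h2 : MemLp (fun x => η x * ‖gradient η x‖) 2 volume :=
      (hη.continuous.mul hgη.norm).memLp_of_hasCompactSupport hηc.mul_right
    exact hGs.norm.integrable_mul (h2.comp_fst _)
  have hFζ : ∀ᵐ z ∂μ, ‖inner ℝ (F z) (gradient ζ z.1)‖ ≤ 2 * C₁ * k z := by
    filter_upwards [hF'] with z hz
    rw [hgζ]
    by_cases hzK : z.1 ∈ K
    · refine (norm_inner_le_norm _ _).trans ?_
      rw [norm_smul, Real.norm_of_nonneg (by linarith [hη0 z.1])]
      have := mul_le_mul_of_nonneg_right (hz hzK).2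
        (mul_nonneg (hη0 z.1) (norm_nonneg (gradient η z.1)))
      simp only [hk]
      linarith
    · simp [hηout _ hzK, hk]
  set I := ∫ z, k z ∂μ with hI
  have hstep : ∀ a b, s ≤ a → a < b → b ≤ t → |m b - m a| ≤ 2 * C₁ * I := by
    intro a b ha hab hb
    have h1 := D.eqn ζ hζ hζc (hζη.trans (hηK.trans interior_subset)) a b ha hab hb
    have h2 : m b - m a = -∫ z, inner ℝ (F z) (gradient ζ z.1)
        ∂(volume.prod (volume.restrict (Ioc a b))) := by
      simp only [hm]; linarith
    have hsub := Ioc_subset_Ioc ha hb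
    have hmono : (volume : Measure V).prod (volume.restrict (Ioc a b)) ≤ μ :=
      Measure.prod_mono le_rfl (Measure.restrict_mono hsub le_rfl)
    rw [h2, abs_neg, ← Real.norm_eq_abs, hI, ← integral_const_mul]
    refine (norm_integral_le_of_norm_le ((hki.const_mul _).mono_measure hmono)
      (ae_slab_mono hsub hFζ)).trans ?_
    exact integral_mono_measure hmono (ae_of_all _ fun z => mul_nonneg (by positivity) (hk0 z))
      (hki.const_mul _)
  have hall : ∀ a ∈ Icc s t, ∀ b ∈ Icc s t, m a ≤ m b + 2 * C₁ * I := by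
    intro a ha b hb
    rcases lt_trichotomy a b with h | h | h
    · have := (abs_le.1 (hstep a b ha.1 h hb.2)).1; linarith
    · have : 0 ≤ I := integral_nonneg hk0
      rw [h]; nlinarith
    · have := (abs_le.1 (hstep b a hb.1 h ha.2)).2; linarith
  -- This bound for the mass contains the unknown `I`; the circularity is resolved by absorption at
  -- the end.
  set S := m τ₂ + 2 * C₁ * I with hS
  have henergy := D.energy_le (f := fun a => Real.arctan (a - l)) (c := 2) (c' := 1) (S := S)
    (ζ := ζ) hKm hst (contDiff_arctan_sub l)
    (fun a b hab => Real.arctan_strictMono.monotone (sub_le_sub_right hab l))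
    (fun a => abs_arctan_le_two _) (abs_deriv_arctan_sub_le l) hζ hζc (hζη.trans hηK)
    (fun x => mul_self_nonneg _) (by
      filter_upwards [ae_restrict_mem measurableSet_Ioc] with τ hτ
      exact hall τ ⟨hτ.1.le, hτ.2⟩ τ₂ h₂)
  set Φ := testGrad (fun a => Real.arctan (a - l)) ζ w G with hΦ
  have hΦ2 : MemLp Φ 2 μ := memLp_testGrad hws.1 hGs (contDiff_arctan_sub l)
    (fun a => abs_arctan_le_two _) (abs_deriv_arctan_sub_le l) hζ hζc
  have hq : Integrable ((K ×ˢ (univ : Set ℝ)).indicator fun z => 1 + (w z - l) ^ 2) μ := by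
    rw [integrable_indicator_iff hKum, IntegrableOn, hμK]
    have : IsFiniteMeasure (volume.restrict K) := ⟨by simpa using hK.measure_lt_top⟩
    have hwK : MemLp w 2 ((volume.restrict K).prod (volume.restrict (Ioc s t))) := by
      rw [← hμK]; exact hws.restrict _
    exact (integrable_const _).add (hwK.sub (memLp_const l)).integrable_sq
  -- `20 = 24 - 4`: Young gives `24`, and the term with `Dζ` costs `4`, a factor `2` from the bound
  -- on `arctan` and a factor `2` from `Dζ`.
  have hpt : ∀ᵐ z ∂μ, 20 * C₁ * k z ≤ inner ℝ (F z) (Φ z) + 144 * C₁ ^ 2 / Co * B ^ 2 *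
      (K ×ˢ (univ : Set ℝ)).indicator (fun z => 1 + (w z - l) ^ 2) z := by
    filter_upwards [hF', hFζ] with z h1 h2
    by_cases hzK : z.1 ∈ K
    · rw [indicator_of_mem (show z ∈ K ×ˢ univ from ⟨hzK, trivial⟩)]
      have hb0 : 0 ≤ ‖gradient η z.1‖ := norm_nonneg _
      have hqpos : 0 < 1 + (w z - l) ^ 2 := by positivity
      have hy := weighted_young (C₁ := C₁) (g := ‖G z‖ * η z.1) (b := ‖gradient η z.1‖) hCo hqpos
      have hb : ‖gradient η z.1‖ ^ 2 ≤ B ^ 2 := pow_le_pow_left₀ hb0 (hB _) 2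
      have hb' : 144 * C₁ ^ 2 / Co * (‖gradient η z.1‖ ^ 2 * (1 + (w z - l) ^ 2)) ≤
          144 * C₁ ^ 2 / Co * (B ^ 2 * (1 + (w z - l) ^ 2)) := by gcongr
      have hin : inner ℝ (F z) (Φ z) = 1 / (1 + (w z - l) ^ 2) * (η z.1 * η z.1) *
          inner ℝ (F z) (G z) + Real.arctan (w z - l) * inner ℝ (F z) (gradient ζ z.1) := by
        simp only [hΦ, testGrad, inner_add_right, inner_smul_right, deriv_arctan_sub, hζdef]
      have hlow : 1 / (1 + (w z - l) ^ 2) * (η z.1 * η z.1) * (Co * ‖G z‖ ^ 2) ≤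
          1 / (1 + (w z - l) ^ 2) * (η z.1 * η z.1) * inner ℝ (F z) (G z) :=
        mul_le_mul_of_nonneg_left (h1 hzK).1 (mul_nonneg (by positivity) (mul_self_nonneg _))
      have hup : |Real.arctan (w z - l) * inner ℝ (F z) (gradient ζ z.1)| ≤ 2 * (2 * C₁ * k z) := by
        rw [abs_mul]
        exact mul_le_mul (abs_arctan_le_two _) h2 (abs_nonneg _) (by norm_num)
      have hup' := (abs_le.1 hup).1
      have e1 : Co * (1 / (1 + (w z - l) ^ 2) * (‖G z‖ * η z.1) ^ 2) =
          1 / (1 + (w z - l) ^ 2) * (η z.1 * η z.1) * (Co * ‖G z‖ ^ 2) := by ring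
      have e2 : ‖G z‖ * η z.1 * ‖gradient η z.1‖ = k z := by simp only [hk]; ring
      rw [e1, e2] at hy
      rw [hin, mul_assoc (144 * C₁ ^ 2 / Co)]
      linarith
    · have hΦ0 : inner ℝ (F z) (Φ z) = 0 := by
        simp only [hΦ, testGrad]
        rw [hgζ]
        simp [hζdef, hηout _ hzK]
      rw [hΦ0, indicator_of_notMem (fun h => hzK h.1)]
      simp [hk, hηout _ hzK]
  have hFΦ := integrable_inner_of_memLp hFs hΦ2
  have hint := integral_mono_ae (hki.const_mul (20 * C₁))
    (hFΦ.add (hq.const_mul (144 * C₁ ^ 2 / Co * B ^ 2))) hpt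
  have hsum : ∫ z, (inner ℝ (F z) (Φ z) + 144 * C₁ ^ 2 / Co * B ^ 2 *
      (K ×ˢ (univ : Set ℝ)).indicator (fun z => 1 + (w z - l) ^ 2) z) ∂μ ≤
      2 * (2 * S) + 144 * C₁ ^ 2 / Co * B ^ 2 * Y := by
    rw [integral_add hFΦ (hq.const_mul _), integral_const_mul, integral_indicator hKum, hμK]
    gcongr
  -- Here `2 * (2 * S)` contains `8 * C₁ * I`. With `e` the error term of the conclusion, `12 * C₁ *
  -- I ≤ 4 * m τ₂ + 6 * e`, so `2 * C₁ * I ≤ (2 / 3) * m τ₂ + e`, whence the factor `5 / 3`.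
  have hfin : 20 * C₁ * I ≤ 2 * (2 * S) + 144 * C₁ ^ 2 / Co * B ^ 2 * Y := by
    rw [hI, ← integral_const_mul]
    exact hint.trans hsum
  have hm1 := hall τ₁ h₁ τ₂ h₂
  have e3 : 144 * C₁ ^ 2 / Co * B ^ 2 * Y = 6 * (24 * C₁ ^ 2 / Co * (B ^ 2 * Y)) := by ring
  rw [e3] at hfin
  simp only [hm] at hm1 hS ⊢
  linarith

end WeakData
end MassEstimate

/-! ### Cubes, Laplacians and cutoff functions -/

section Cubes

variable {N : ℕ}

theorem cube_eq_preimage (y : Sp N) (ρ : ℝ) :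
    cube y ρ = (MeasurableEquiv.toLp 2 (Fin N → ℝ)).symm ⁻¹'
      (Set.pi univ fun i => Icc (y i - ρ / 2) (y i + ρ / 2)) := by
  ext x
  rw [mem_preimage, Set.mem_univ_pi]
  refine forall_congr' fun i => ?_
  change |x i - y i| ≤ ρ / 2 ↔ y i - ρ / 2 ≤ x i ∧ x i ≤ y i + ρ / 2
  rw [abs_le]
  constructor <;> rintro ⟨h1, h2⟩ <;> constructor <;> linarith

theorem volume_cube (y : Sp N) (ρ : ℝ) : volume (cube y ρ) = ENNReal.ofReal ρ ^ N := by
  rw [cube_eq_preimage,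
    (EuclideanSpace.volume_preserving_symm_measurableEquiv_toLp (Fin N)).measure_preimage_equiv,
    volume_pi_pi]
  simp only [Real.volume_Icc]
  ring_nf
  simp

theorem isCompact_cube (y : Sp N) (ρ : ℝ) : IsCompact (cube y ρ) := by
  have h : cube y ρ = (EuclideanSpace.equiv (Fin N) ℝ).toHomeomorph ⁻¹'
      (Set.pi univ fun i => Icc (y i - ρ / 2) (y i + ρ / 2)) := cube_eq_preimage y ρ
  rw [h, Homeomorph.isCompact_preimage]
  exact isCompact_univ_pi fun i => isCompact_Icc

theorem subset_interior_cube (y : Sp N) (ρ : ℝ) :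
    {x : Sp N | ∀ i, |x i - y i| < ρ / 2} ⊆ interior (cube y ρ) := by
  refine interior_maximal (fun x hx i => (hx i).le) ?_
  simp only [ofPred_forall]
  exact isOpen_iInter_of_finite fun i => isOpen_lt (by fun_prop) continuous_const

theorem self_mem_cube {y : Sp N} {ρ : ℝ} (hρ : 0 ≤ ρ) : y ∈ cube y ρ := fun i => by
  simp; linarith

theorem cube_subset_cube (y : Sp N) {ρ ρ' : ℝ} (h : ρ ≤ ρ') : cube y ρ ⊆ cube y ρ' :=
  fun _ hx i => (hx i).trans (by linarith)

end Cubes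

section Laplacian

variable {N : ℕ} {F : Type*} [NormedAddCommGroup F] [NormedSpace ℝ F]

theorem laplacian_eq_sum (f : Sp N → ℝ) (x : Sp N) :
    Laplacian.laplacian f x = ∑ i, fderiv ℝ (fderiv ℝ f) x (EuclideanSpace.basisFun (Fin N) ℝ i)
      (EuclideanSpace.basisFun (Fin N) ℝ i) := by
  rw [InnerProductSpace.laplacian_eq_iteratedFDeriv_orthonormalBasis f
    (EuclideanSpace.basisFun (Fin N) ℝ)]
  simp [iteratedFDeriv_two_apply]

theorem fderiv_comp_affine {g : Sp N → F} (hg : Differentiable ℝ g) (a : ℝ) (y x : Sp N) :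
    fderiv ℝ (fun x => g (a • (x - y))) x = a • fderiv ℝ g (a • (x - y)) := by
  have h := (hg (a • (x - y))).hasFDerivAt.comp x
    (((hasFDerivAt_id x).sub_const y).const_smul a)
  have h' : fderiv ℝ (fun x => g (a • (x - y))) x = _ := h.fderiv
  rw [h']
  ext v
  simp

theorem fderiv_fderiv_comp_affine {g : Sp N → ℝ} (hg : ContDiff ℝ ∞ g) (a : ℝ) (y x : Sp N) :
    fderiv ℝ (fderiv ℝ fun x => g (a • (x - y))) x =
      (a * a) • fderiv ℝ (fderiv ℝ g) (a • (x - y)) := by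
  have h1 : (fderiv ℝ fun x => g (a • (x - y))) = fun x => a • fderiv ℝ g (a • (x - y)) :=
    funext fun x => fderiv_comp_affine (hg.differentiable (by simp)) a y x
  have hd : Differentiable ℝ (fderiv ℝ g) :=
    (hg.fderiv_right (m := ∞) (by simp)).differentiable (by simp)
  have hd' : DifferentiableAt ℝ (fun x => fderiv ℝ g (a • (x - y))) x := by fun_prop
  rw [h1, fderiv_fun_const_smul hd', fderiv_comp_affine hd, smul_smul]

theorem laplacian_comp_affine {g : Sp N → ℝ} (hg : ContDiff ℝ ∞ g) (a : ℝ) (y x : Sp N) :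
    Laplacian.laplacian (fun x => g (a • (x - y))) x =
      (a * a) * Laplacian.laplacian g (a • (x - y)) := by
  simp only [laplacian_eq_sum, fderiv_fderiv_comp_affine hg, Finset.mul_sum]
  rfl

theorem laplacian_eq_zero_of_notMem {f : Sp N → ℝ} {x : Sp N} (hx : x ∉ tsupport f) :
    Laplacian.laplacian f x = 0 := by
  have h1 : x ∉ tsupport (fderiv ℝ (fderiv ℝ f)) := fun h =>
    hx (tsupport_fderiv_subset ℝ (tsupport_fderiv_subset ℝ h))
  rw [laplacian_eq_sum, image_eq_zero_of_notMem_tsupport h1]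
  simp

theorem hasCompactSupport_laplacian {f : Sp N → ℝ} (hf : HasCompactSupport f) :
    HasCompactSupport (Laplacian.laplacian f) :=
  HasCompactSupport.intro hf.isCompact fun _ hx => laplacian_eq_zero_of_notMem hx

theorem continuous_laplacian {f : Sp N → ℝ} (hf : ContDiff ℝ ∞ f) :
    Continuous (Laplacian.laplacian f) := by
  have h : Continuous (fderiv ℝ (fderiv ℝ f)) :=
    (hf.fderiv_right (m := ∞) (by simp)).continuous_fderiv (by simp)
  rw [funext (laplacian_eq_sum f)]
  fun_prop

/-- Each pure second derivative integrates to zero, by parts against the constant `1`. This allows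
the constant `ln M` to be subtracted from `ln u` in the distributional case. -/
theorem integral_laplacian {f : Sp N → ℝ} (hf : ContDiff ℝ ∞ f) (hfc : HasCompactSupport f) :
    ∫ x, Laplacian.laplacian f x = 0 := by
  have hd : ContDiff ℝ ∞ (fderiv ℝ f) := hf.fderiv_right (m := ∞) (by simp)
  have hc : Continuous (fderiv ℝ (fderiv ℝ f)) := hd.continuous_fderiv (by simp)
  have hcc : HasCompactSupport (fderiv ℝ (fderiv ℝ f)) := (hfc.fderiv ℝ).fderiv ℝ
  have hi : ∀ v : Sp N, Integrable (fun x => fderiv ℝ (fderiv ℝ f) x v v) volume := fun v =>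
    Continuous.integrable_of_hasCompactSupport (by fun_prop)
      (hcc.comp_left (g := fun L : Sp N →L[ℝ] Sp N →L[ℝ] ℝ => L v v) (by simp))
  have hz : ∀ v : Sp N, ∫ x, fderiv ℝ (fderiv ℝ f) x v v = 0 := fun v => by
    have hdv : ContDiff ℝ ∞ (fun x => fderiv ℝ f x v) := hd.clm_apply contDiff_const
    have hfd : ∀ x, fderiv ℝ (fun x => fderiv ℝ f x v) x v = fderiv ℝ (fderiv ℝ f) x v v :=
      fun x => by
        rw [fderiv_clm_apply (hd.differentiable (by simp) x) (differentiableAt_const _)]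
        simp
    have hi0 : Integrable (fun x => fderiv ℝ f x v) volume :=
      hdv.continuous.integrable_of_hasCompactSupport
        ((hfc.fderiv ℝ).comp_left (g := fun L : Sp N →L[ℝ] ℝ => L v) (by simp))
    have := integral_mul_fderiv_eq_neg_fderiv_mul_of_integrable (μ := (volume : Measure (Sp N)))
      (f := fun _ : Sp N => (1 : ℝ)) (g := fun x => fderiv ℝ f x v) (v := v) (by simp)
      (by simpa [hfd] using hi v) (by simpa using hi0) (by simp)
      (fun x _ => (hdv.differentiable (by simp)) x)
    simpa [hfd] using this
  simp_rw [laplacian_eq_sum]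
  rw [integral_finsetSum _ fun i _ => hi _]
  simp [hz]

end Laplacian

section Cutoff

theorem exists_unit_cutoff (N : ℕ) : ∃ η : Sp N → ℝ, ContDiff ℝ ∞ η ∧
    (∀ x, 0 ≤ η x ∧ η x ≤ 1) ∧ (∀ x, (∀ i, |x i| ≤ 1 / 2) → η x = 1) ∧
    ∀ x ∈ tsupport η, ∀ i, |x i| ≤ 3 / 4 := by
  -- After scaling by `ρ`, the product of these bumps is `1` on the cube of edge `ρ`, and its
  -- support stays within `3ρ/4 < ρ` of the centre in each coordinate, hence in the interior of the
  -- cube of edge `2ρ`.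
  let b : ContDiffBump (0 : ℝ) := ⟨1 / 2, 3 / 4, by norm_num, by norm_num⟩
  refine ⟨fun x => ∏ i, b (x i), ?_, fun x => ⟨?_, ?_⟩, fun x hx => ?_, ?_⟩
  · exact contDiff_prod fun i _ => b.contDiff.comp (by fun_prop)
  · exact Finset.prod_nonneg fun i _ => b.nonneg
  · exact Finset.prod_le_one (fun i _ => b.nonneg) fun i _ => b.le_one
  · exact Finset.prod_eq_one fun i _ => b.one_of_mem_closedBall (by simpa [b] using hx i)
  · have hcl : IsClosed {x : Sp N | ∀ i, |x i| ≤ 3 / 4} := by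
      simp only [ofPred_forall]
      exact isClosed_iInter fun i => isClosed_le (by fun_prop) continuous_const
    refine closure_minimal (fun x hx i => ?_) hcl
    have h1 : b (x i) ≠ 0 := fun h => hx (Finset.prod_eq_zero (Finset.mem_univ i) h)
    have h2 : x i ∈ Function.support b := h1
    rw [b.support_eq, mem_ball_zero_iff] at h2
    exact h2.le

theorem abs_rescale {N : ℕ} {ρ : ℝ} (hρ : 0 < ρ) (x y : Sp N) (i : Fin N) :
    |(ρ⁻¹ • (x - y)) i| = ρ⁻¹ * |x i - y i| := by
  rw [PiLp.smul_apply, PiLp.sub_apply, smul_eq_mul, abs_mul, abs_inv, abs_of_pos hρ]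

/-- Cutoff functions between a cube and the concentric cube of twice the edge. -/
theorem exists_cutoff (N : ℕ) : ∃ C : ℝ, 0 < C ∧ ∀ (y : Sp N) (ρ : ℝ), 0 < ρ →
    ∃ η : Sp N → ℝ, ContDiff ℝ ∞ η ∧ HasCompactSupport η ∧
      tsupport η ⊆ interior (cube y (2 * ρ)) ∧ (∀ x, 0 ≤ η x ∧ η x ≤ 1) ∧
      (∀ x ∈ cube y ρ, η x = 1) ∧ (∀ x, ‖gradient η x‖ ≤ C / ρ) ∧
      ∀ x, |Laplacian.laplacian η x| ≤ C / ρ ^ 2 := by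
  obtain ⟨η, hη, h01, h1, hsupp⟩ := exists_unit_cutoff N
  have hηc : HasCompactSupport η := by
    refine (isCompact_cube (0 : Sp N) 2).of_isClosed_subset (isClosed_tsupport η) fun x hx i => ?_
    have := hsupp x hx i
    simp; linarith
  have hd : ContDiff ℝ ∞ (fderiv ℝ η) := hη.fderiv_right (m := ∞) (by simp)
  obtain ⟨A, hA⟩ := (hηc.fderiv ℝ).exists_bound_of_continuous hd.continuous
  obtain ⟨B, hB⟩ := (hasCompactSupport_laplacian hηc).exists_bound_of_continuous
    (continuous_laplacian hη)
  refine ⟨max 1 (max A (B)), lt_max_of_lt_left one_pos, fun y ρ hρ => ?_⟩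
  have hin : ∀ x ∈ tsupport (fun x => η (ρ⁻¹ • (x - y))), ∀ i, |x i - y i| ≤ 3 / 4 * ρ := by
    have hcl : IsClosed {x : Sp N | ∀ i, |x i - y i| ≤ 3 / 4 * ρ} := by
      simp only [ofPred_forall]
      exact isClosed_iInter fun i => isClosed_le (by fun_prop) continuous_const
    refine closure_minimal (fun x hx i => ?_) hcl
    have h2 := hsupp _ (subset_tsupport η hx) i
    rwa [abs_rescale hρ, inv_mul_le_iff₀ hρ, mul_comm] at h2
  refine ⟨fun x => η (ρ⁻¹ • (x - y)),
    hη.comp (by fun_prop), ?_, ?_, fun x => h01 _,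
    fun x hx => h1 _ fun i => ?_, fun x => ?_, fun x => ?_⟩
  · refine (isCompact_cube y (2 * ρ)).of_isClosed_subset (isClosed_tsupport _) fun x hx i => ?_
    linarith [hin x hx i]
  · exact fun x hx => subset_interior_cube y (2 * ρ) fun i => by linarith [hin x hx i]
  · rw [abs_rescale hρ, inv_mul_le_iff₀ hρ]
    linarith [hx i]
  · rw [norm_gradient, fderiv_comp_affine (hη.differentiable (by simp)), norm_smul,
      Real.norm_of_nonneg (inv_nonneg.2 hρ.le), inv_mul_eq_div]
    exact div_le_div_of_nonneg_right
      ((hA _).trans ((le_max_left _ _).trans (le_max_right _ _))) hρ.le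
  · rw [laplacian_comp_affine hη, abs_mul, abs_of_nonneg (mul_self_nonneg _), ← mul_inv,
      inv_mul_eq_div, ← sq]
    exact div_le_div_of_nonneg_right
      ((hB _).trans ((le_max_right _ _).trans (le_max_right _ _))) (sq_nonneg ρ)

end Cutoff

/-! ### Normalized averages and the quantities `M` and `Λ_q` -/

section Averages

variable {N : ℕ}

/-- Lebesgue measure on `K`, normalized to total mass one. -/
noncomputable def normalizedVolume (K : Set (Sp N)) : Measure (Sp N) :=
  (volume K)⁻¹ • volume.restrict K

theorem isProbabilityMeasure_normalizedVolume {K : Set (Sp N)} (h0 : volume K ≠ 0)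
    (h1 : volume K ≠ ⊤) : IsProbabilityMeasure (normalizedVolume K) :=
  ⟨by simp [normalizedVolume, ENNReal.inv_mul_cancel h0 h1]⟩

/-- Seen as a norm for a probability measure, the average becomes monotone in the exponent. -/
theorem laverage_rpow_eq_eLpNorm (K : Set (Sp N)) (g : Sp N → ℝ) {q : ℝ} (hq : 0 < q) :
    (⨍⁻ x in K, ENNReal.ofReal |g x| ^ q ∂volume) ^ (1 / q) =
      eLpNorm g (ENNReal.ofReal q) (normalizedVolume K) := by
  rw [eLpNorm_eq_lintegral_rpow_enorm_toReal (by simpa using hq) ENNReal.ofReal_ne_top,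
    ENNReal.toReal_ofReal hq.le]
  simp only [laverage, Measure.restrict_apply_univ, normalizedVolume, Real.enorm_eq_ofReal_abs]

theorem lintegral_eq_mul_normalizedVolume {K : Set (Sp N)} (h0 : volume K ≠ 0)
    (h1 : volume K ≠ ⊤) (f : Sp N → ℝ≥0∞) :
    ∫⁻ x in K, f x = volume K * ∫⁻ x, f x ∂(normalizedVolume K) := by
  rw [normalizedVolume, lintegral_smul_measure, smul_eq_mul, ← mul_assoc,
    ENNReal.mul_inv_cancel h0 h1, one_mul]

theorem volume_cube_ne_zero (y : Sp N) {ρ : ℝ} (hρ : 0 < ρ) : volume (cube y ρ) ≠ 0 := by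
  rw [volume_cube]
  exact pow_ne_zero _ (by simpa using hρ)

theorem volume_cube_ne_top (y : Sp N) (ρ : ℝ) : volume (cube y ρ) ≠ ⊤ :=
  (isCompact_cube y ρ).measure_lt_top.ne

end Averages

section Cylinder

variable {N : ℕ} {E : Set (Sp N)} {T : ℝ} {u : Sp N → ℝ → ℝ} {y : Sp N} {ρ s t p : ℝ}

theorem cyl_subset (hρ : 0 < ρ) (hst : s < t) (h : cube y (2 * ρ) ×ˢ Icc s t ⊆ cyl E T) :
    0 < s ∧ t ≤ T ∧ cube y (2 * ρ) ⊆ E := by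
  have hy : y ∈ cube y (2 * ρ) := self_mem_cube (by linarith)
  refine ⟨(h (mk_mem_prod hy (left_mem_Icc.2 hst.le))).2.1,
    (h (mk_mem_prod hy (right_mem_Icc.2 hst.le))).2.2, fun x hx => ?_⟩
  exact (h (mk_mem_prod hx (left_mem_Icc.2 hst.le))).1

theorem isCompact_closedCylinder : IsCompact (cube y (2 * ρ) ×ˢ Icc s t) :=
  (isCompact_cube _ _).prod isCompact_Icc

theorem restrict_prod_eq {α β : Type*} [MeasureSpace α] [MeasureSpace β]
    [SFinite (volume : Measure α)] [SFinite (volume : Measure β)] (A : Set α) (B : Set β) :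
    (volume : Measure (α × β)).restrict (A ×ˢ B) =
      (volume.restrict A).prod (volume.restrict B) := by
  rw [Measure.prod_restrict]; rfl

theorem ae_prod_swap {α β : Type*} [MeasurableSpace α] [MeasurableSpace β] {μ : Measure α}
    {ν : Measure β} [SFinite μ] [SFinite ν] {P : α × β → Prop} (h : ∀ᵐ z ∂(μ.prod ν), P z) :
    ∀ᵐ b ∂ν, ∀ᵐ a ∂μ, P (a, b) :=
  Measure.ae_ae_of_ae_prod (Measure.measurePreserving_swap.quasiMeasurePreserving.ae h)

theorem NonnegLogFinite.ae_pos (hu : NonnegLogFinite E T u)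
    (h : cube y (2 * ρ) ×ˢ Icc s t ⊆ cyl E T) :
    ∀ᵐ z ∂((volume.restrict (cube y (2 * ρ))).prod (volume.restrict (Icc s t))),
      0 < u z.1 z.2 := by
  rw [← restrict_prod_eq]
  refine ae_restrict_of_ae_restrict_of_subset h ?_
  filter_upwards [hu.nonneg, hu.ne_zero] with z h1 h2
  exact lt_of_le_of_ne h1 h2.symm

/-- If the essential supremum were `0`, then `u ≤ 0` a.e. on a set of positive measure; if it were
infinite, `toReal` would return `0`, which local boundedness excludes. Positivity is what gives
`ln(u / M) = ln u - ln M`. -/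
theorem supM_pos (hρ : 0 < ρ) (hst : s < t) (h : cube y (2 * ρ) ×ˢ Icc s t ⊆ cyl E T)
    (hu : NonnegLogFinite E T u) (hb : MemLpLoc E T u ⊤) : 0 < supM u y ρ s t := by
  refine ENNReal.toReal_pos (fun h0 => ?_) (ne_of_lt ?_)
  · rw [ENNReal.essSup_eq_zero_iff] at h0
    have h1 : ∀ᵐ z ∂(volume.restrict (cube y (2 * ρ) ×ˢ Ioc s t)), False := by
      have hpos := hu.ae_pos h
      rw [← restrict_prod_eq] at hpos
      filter_upwards [h0, ae_restrict_of_ae_restrict_of_subset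
        (prod_mono_right Ioc_subset_Icc_self) hpos] with z h2 h3
      simp only [Pi.zero_apply, ENNReal.ofReal_eq_zero] at h2
      linarith
    rw [eventually_false_iff_eq_bot, ae_eq_bot, restrict_prod_eq] at h1
    have h2 : (volume.restrict (cube y (2 * ρ))).prod (volume.restrict (Ioc s t)) univ = 0 := by
      rw [h1]; simp
    rw [← univ_prod_univ, Measure.prod_prod] at h2
    simp only [Measure.restrict_apply_univ, Real.volume_Ioc, mul_eq_zero, ENNReal.ofReal_eq_zero]
      at h2
    rcases h2 with h2 | h2
    · exact volume_cube_ne_zero y (by linarith) h2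
    · linarith
  · have h1 := (hb _ isCompact_closedCylinder h).2
    rw [eLpNorm_exponent_top, eLpNormEssSup] at h1
    refine lt_of_le_of_lt ?_ h1
    refine (essSup_mono_ae (ae_of_all _ fun z => ?_)).trans (essSup_mono_measure'
      (Measure.restrict_mono (prod_mono_right Ioc_subset_Icc_self) le_rfl))
    rw [Real.enorm_eq_ofReal_abs]
    exact ENNReal.ofReal_le_ofReal (le_abs_self _)

/-- The quantity `Λ_q` is finite and bounds the averages for almost every time. -/
theorem ae_eLpNorm_le_Lam (hρ : 0 < ρ) (hst : s < t)
    (h : cube y (2 * ρ) ×ˢ Icc s t ⊆ cyl E T)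
    (hu : NonnegLogFinite E T u) (hb : MemLpLoc E T u ⊤)
    (hlog : MemLinftyLpLoc E T (fun x τ => Real.log (u x τ)) p) {q : ℝ} (hq : 1 ≤ q)
    (hqp : q ≤ p) :
    ∀ᵐ τ ∂(volume.restrict (Icc s t)),
      AEStronglyMeasurable (fun x => Real.log (u x τ / supM u y ρ s t))
        (normalizedVolume (cube y (2 * ρ))) ∧
      (∀ᵐ x ∂(volume.restrict (cube y (2 * ρ))), 0 < u x τ ∧
        Real.log (u x τ / supM u y ρ s t) = Real.log (u x τ) - Real.log (supM u y ρ s t)) ∧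
      eLpNorm (fun x => Real.log (u x τ / supM u y ρ s t)) (ENNReal.ofReal q)
        (normalizedVolume (cube y (2 * ρ))) ≤ ENNReal.ofReal (Lam u y ρ s t q) := by
  set K := cube y (2 * ρ) with hK
  set M := supM u y ρ s t with hM
  have hMpos : 0 < M := supM_pos hρ hst h hu hb
  have hq0 : 0 < q := by linarith
  obtain ⟨hs, htT, hKE⟩ := cyl_subset hρ hst h
  have hv0 : volume K ≠ 0 := volume_cube_ne_zero y (by linarith)
  have hv1 : volume K ≠ ⊤ := volume_cube_ne_top y _
  have hprob := isProbabilityMeasure_normalizedVolume hv0 hv1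
  have hac : normalizedVolume K ≪ volume.restrict K := Measure.smul_absolutelyContinuous
  have hms : ∀ᵐ τ ∂(volume.restrict (Icc s t)),
      AEStronglyMeasurable (fun x => Real.log (u x τ)) (volume.restrict K) := by
    have h1 := hlog.1.mono_measure (Measure.restrict_mono h le_rfl)
    rw [restrict_prod_eq] at h1
    exact h1.prod_swap.prodMk_left
  have hcmp : ∀ᵐ τ ∂(volume.restrict (Icc s t)),
      AEStronglyMeasurable (fun x => Real.log (u x τ / M)) (normalizedVolume K) ∧
      (∀ᵐ x ∂(volume.restrict K), 0 < u x τ ∧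
        Real.log (u x τ / M) = Real.log (u x τ) - Real.log M) := by
    filter_upwards [hms, ae_prod_swap (hu.ae_pos h)] with τ h1 h2
    have h3 : ∀ᵐ x ∂(volume.restrict K), 0 < u x τ ∧
        Real.log (u x τ / M) = Real.log (u x τ) - Real.log M := by
      filter_upwards [h2] with x hx
      exact ⟨hx, Real.log_div hx.ne' hMpos.ne'⟩
    refine ⟨?_, h3⟩
    have h4 : AEStronglyMeasurable (fun x => Real.log (u x τ) - Real.log M)
        (volume.restrict K) := h1.sub aestronglyMeasurable_const
    exact (h4.congr (h3.mono fun x hx => hx.2.symm)).mono_ac hac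
  have hLam : Lam u y ρ s t q = (essSup (fun τ => eLpNorm (fun x => Real.log (u x τ / M))
      (ENNReal.ofReal q) (normalizedVolume K)) (volume.restrict (Icc s t))).toReal := by
    rw [Lam]
    simp only [← hM, ← hK, laverage_rpow_eq_eLpNorm K _ hq0]
  -- `Lam` is a `toReal`, so it bounds the averages only if the essential supremum is finite.
  -- Passing from `q` to `p` and subtracting the constant `ln M` reduces this to the hypothesis on
  -- `ln u`.
  have hfin : essSup (fun τ => eLpNorm (fun x => Real.log (u x τ / M))
      (ENNReal.ofReal q) (normalizedVolume K)) (volume.restrict (Icc s t)) < ⊤ := by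
    set A := essSup (fun τ => eLpNorm (fun x => Real.log (u x τ)) (ENNReal.ofReal p)
      (volume.restrict K)) (volume.restrict (Icc s t)) with hA
    have hAfin : A < ⊤ := hlog.2 K (isCompact_cube _ _) hKE s t hs htT
    have hp0 : ENNReal.ofReal p ≠ 0 := by simp; linarith
    have hp1 : 1 ≤ ENNReal.ofReal p := by simp; linarith
    have hbound : ∀ᵐ τ ∂(volume.restrict (Icc s t)), eLpNorm (fun x => Real.log (u x τ / M))
        (ENNReal.ofReal q) (normalizedVolume K) ≤
        (volume K)⁻¹ ^ (1 / ENNReal.ofReal p).toReal * A + ‖Real.log M‖ₑ := by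
      filter_upwards [hcmp, hms, ENNReal.ae_le_essSup (μ := volume.restrict (Icc s t))
        (fun τ => eLpNorm (fun x => Real.log (u x τ)) (ENNReal.ofReal p)
        (volume.restrict K))] with τ h1 h2 h3
      calc _ ≤ eLpNorm (fun x => Real.log (u x τ / M)) (ENNReal.ofReal p) (normalizedVolume K) :=
            eLpNorm_le_eLpNorm_of_exponent_le (ENNReal.ofReal_le_ofReal hqp) h1.1
        _ = eLpNorm (fun x => Real.log (u x τ) - Real.log M) (ENNReal.ofReal p)
            (normalizedVolume K) :=
            eLpNorm_congr_ae (hac.ae_le (h1.2.mono fun x hx => hx.2))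
        _ ≤ eLpNorm (fun x => Real.log (u x τ)) (ENNReal.ofReal p) (normalizedVolume K) +
            eLpNorm (fun _ => Real.log M) (ENNReal.ofReal p) (normalizedVolume K) :=
            eLpNorm_sub_le (h2.mono_ac hac) aestronglyMeasurable_const hp1
        _ ≤ _ := by
            rw [eLpNorm_const _ hp0 hprob.ne_zero, measure_univ, ENNReal.one_rpow, mul_one,
              normalizedVolume, eLpNorm_smul_measure_of_ne_top ENNReal.ofReal_ne_top, smul_eq_mul]
            gcongr
    refine (essSup_le_of_ae_le _ hbound).trans_lt ?_
    refine ENNReal.add_lt_top.2 ⟨ENNReal.mul_lt_top ?_ hAfin, by simp⟩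
    exact ENNReal.rpow_lt_top_of_nonneg (by positivity) (by simpa using hv0)
  rw [hLam, ENNReal.ofReal_toReal hfin.ne]
  filter_upwards [hcmp, ENNReal.ae_le_essSup (μ := volume.restrict (Icc s t))
    (fun τ => eLpNorm (fun x => Real.log (u x τ / M)) (ENNReal.ofReal q) (normalizedVolume K))]
    with τ h1 h2
  exact ⟨h1.1, h1.2, h2⟩

end Cylinder

/-! ### Functions of time with bounded weak derivative -/

section OneDimensional

theorem abs_moll_le {g : ℝ → ℝ} {B : ℝ} (hgB : ∀ᵐ x, |g x| ≤ B) (n : ℕ) (x : ℝ) :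
    |moll n g x| ≤ B := by
  have hi : Integrable (fun z => (bump ℝ n).normed volume (x - z) * B) volume :=
    ((bump ℝ n).integrable_normed.comp_sub_left x).mul_const B
  rw [moll_eq, ← Real.norm_eq_abs]
  refine (norm_integral_le_of_norm_le hi ?_).trans ?_
  · filter_upwards [hgB] with z hz
    rw [norm_smul, Real.norm_of_nonneg ((bump ℝ n).nonneg_normed _)]
    exact mul_le_mul_of_nonneg_left hz ((bump ℝ n).nonneg_normed _)
  · rw [integral_mul_const, integral_sub_left_eq_self (fun z => (bump ℝ n).normed volume z),
      (bump ℝ n).integral_normed, one_mul]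

/-- A function on an interval whose weak derivative is bounded by `B` agrees almost everywhere with
a `B`-Lipschitz function. -/
theorem ae_abs_sub_le_of_weak_deriv {m L : ℝ → ℝ} {s t B : ℝ}
    (hm : IntegrableOn m (Ioo s t) volume) (hL : IntegrableOn L (Ioo s t) volume)
    (hLB : ∀ᵐ τ ∂(volume.restrict (Ioo s t)), |L τ| ≤ B)
    (hw : ∀ χ : ℝ → ℝ, ContDiff ℝ ∞ χ → HasCompactSupport χ → tsupport χ ⊆ Ioo s t →
      ∫ τ in Ioo s t, (m τ * deriv χ τ + L τ * χ τ) = 0) :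
    ∀ᵐ a ∂(volume.restrict (Ioo s t)), ∀ᵐ b ∂(volume.restrict (Ioo s t)),
      |m a - m b| ≤ B * (t - s) := by
  rcases le_or_gt t s with hts | hst
  · simp [Ioo_eq_empty (not_lt.2 hts)]
  set m₀ := (Ioo s t).indicator m with hm₀
  set L₀ := (Ioo s t).indicator L with hL₀
  have hmi : Integrable m₀ volume := hm.integrable_indicator measurableSet_Ioo
  have hLi : Integrable L₀ volume := hL.integrable_indicator measurableSet_Ioo
  have hne : (volume.restrict (Ioo s t)) ≠ 0 := by
    rw [Ne, Measure.restrict_eq_zero, Real.volume_Ioo, ENNReal.ofReal_eq_zero]; linarith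
  have hB0 : 0 ≤ B := by
    have : (ae (volume.restrict (Ioo s t))).NeBot := ae_neBot.2 hne
    obtain ⟨τ, hτ⟩ := hLB.exists
    exact (abs_nonneg _).trans hτ
  have hL₀B : ∀ᵐ τ, |L₀ τ| ≤ B := by
    rw [ae_restrict_iff' measurableSet_Ioo] at hLB
    filter_upwards [hLB] with τ hτ
    by_cases h : τ ∈ Ioo s t
    · rw [hL₀, indicator_of_mem h]; exact hτ h
    · rw [hL₀, indicator_of_notMem h]; simpa using hB0
  have hwg : ∀ φ : ℝ → ℝ, ContDiff ℝ ∞ φ → HasCompactSupport φ → tsupport φ ⊆ Ioo s t →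
      ∫ x, m₀ x • gradient φ x = -∫ x, φ x • L₀ x := by
    intro φ h1 h2 h3
    have hd : Continuous (deriv φ) := h1.continuous_deriv (by simp)
    have i1 : Integrable (fun x => m₀ x * deriv φ x) volume := by
      have := hmi.locallyIntegrable.integrable_smul_right_of_hasCompactSupport hd h2.deriv
      simpa using this
    have i2 : Integrable (fun x => L₀ x * φ x) volume := by
      have := hLi.locallyIntegrable.integrable_smul_right_of_hasCompactSupport h1.continuous h2
      simpa using this
    have h4 := hw φ h1 h2 h3
    rw [← integral_indicator measurableSet_Ioo] at h4
    have h5 : (Ioo s t).indicator (fun τ => m τ * deriv φ τ + L τ * φ τ) =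
        fun τ => m₀ τ * deriv φ τ + L₀ τ * φ τ := by
      ext τ
      by_cases h : τ ∈ Ioo s t <;> simp [hm₀, hL₀, h]
    rw [h5, integral_add i1 i2] at h4
    simp only [gradient_eq_deriv', smul_eq_mul]
    rw [eq_neg_iff_add_eq_zero, ← h4]
    simp only [mul_comm]
  -- For fixed `a ≤ b` inside the interval and `n` large, the derivative of the mollification on
  -- `[a, b]` is the mollification of `L₀`, hence at most `B`; the mean value inequality passes to
  -- the limit at a.e. pair of times.
  have hlip : ∀ a ∈ Ioo s t, ∀ b ∈ Ioo s t, a ≤ b → ∀ᶠ n in atTop,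
      |moll n m₀ a - moll n m₀ b| ≤ B * (t - s) := by
    intro a ha b hb hab
    have hδ : 0 < min (a - s) (t - b) := lt_min (by linarith [ha.1]) (by linarith [hb.2])
    filter_upwards [(tendsto_bump_rOut (V := ℝ)).eventually (gt_mem_nhds hδ)] with n hn
    have hdiff : Differentiable ℝ (moll n m₀) :=
      (contDiff_moll hmi.locallyIntegrable n).differentiable (by simp)
    have hder : ∀ x ∈ Icc a b, ‖deriv (moll n m₀) x‖ ≤ B := by
      intro x hx
      have := fderiv_moll hmi.locallyIntegrable hLi.locallyIntegrable hwg (n := n) (x := x) (by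
        rw [Real.closedBall_eq_Icc]
        exact Icc_subset_Ioo (by linarith [hx.1, min_le_left (a - s) (t - b)])
          (by linarith [hx.2, min_le_right (a - s) (t - b)]))
      rw [gradient_eq_deriv'] at this
      rw [this]
      exact abs_moll_le hL₀B n x
    have := (convex_Icc a b).norm_image_sub_le_of_norm_deriv_le (fun x _ => hdiff x) hder
      (right_mem_Icc.2 hab) (left_mem_Icc.2 hab)
    rw [← Real.norm_eq_abs]
    refine this.trans (mul_le_mul_of_nonneg_left ?_ hB0)
    rw [Real.norm_eq_abs, abs_sub_comm, abs_of_nonneg (by linarith)]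
    linarith [ha.1, hb.2]
  have hconv := ae_tendsto_moll hmi.locallyIntegrable
  have key : ∀ a ∈ Ioo s t, Tendsto (fun n => moll n m₀ a) atTop (𝓝 (m₀ a)) →
      ∀ b ∈ Ioo s t, Tendsto (fun n => moll n m₀ b) atTop (𝓝 (m₀ b)) → a ≤ b →
      |m a - m b| ≤ B * (t - s) := by
    intro a ha hta b hb htb hab
    rw [hm₀, indicator_of_mem ha] at hta
    rw [hm₀, indicator_of_mem hb] at htb
    exact le_of_tendsto (hta.sub htb).abs (hlip a ha b hb hab)
  filter_upwards [ae_restrict_of_ae hconv, ae_restrict_mem measurableSet_Ioo] with a hta ha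
  filter_upwards [ae_restrict_of_ae hconv, ae_restrict_mem measurableSet_Ioo] with b htb hb
  rcases le_total a b with hab | hab
  · exact key a ha hta b hb htb hab
  · rw [abs_sub_comm]; exact key b hb htb a ha hta hab

end OneDimensional

/-! ### Mass of a cube against mass weighted by a cutoff -/

section Mass

variable {N : ℕ} {u : Sp N → ℝ → ℝ} {y : Sp N} {ρ τ : ℝ} {η : Sp N → ℝ}

theorem mass_le_ofReal (hρ : 0 < ρ)
    (h0 : ∀ᵐ x ∂(volume.restrict (cube y (2 * ρ))), 0 ≤ u x τ)
    (hi : Integrable (fun x => u x τ * η x) (volume.restrict (cube y (2 * ρ))))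
    (hη0 : ∀ x, 0 ≤ η x) (hη1 : ∀ x ∈ cube y ρ, η x = 1) :
    mass u y ρ τ ≤ ENNReal.ofReal (∫ x in cube y (2 * ρ), u x τ * η x) := by
  rw [ofReal_integral_eq_lintegral_ofReal hi
    (h0.mono fun x hx => mul_nonneg hx (hη0 x)), mass]
  calc ∫⁻ x in cube y ρ, ENNReal.ofReal (u x τ)
      = ∫⁻ x in cube y ρ, ENNReal.ofReal (u x τ * η x) := by
        refine setLIntegral_congr_fun (isCompact_cube y ρ).isClosed.measurableSet fun x hx => ?_
        simp [hη1 x hx]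
    _ ≤ _ := lintegral_mono_set (cube_subset_cube y (by linarith))

theorem ofReal_le_mass (hi : Integrable (fun x => u x τ * η x) (volume.restrict (cube y ρ)))
    (h0 : ∀ᵐ x ∂(volume.restrict (cube y ρ)), 0 ≤ u x τ)
    (hη0 : ∀ x, 0 ≤ η x) (hη1 : ∀ x, η x ≤ 1) :
    ENNReal.ofReal (∫ x in cube y ρ, u x τ * η x) ≤ mass u y ρ τ := by
  rw [ofReal_integral_eq_lintegral_ofReal hi
    (h0.mono fun x hx => mul_nonneg hx (hη0 x)), mass]
  refine lintegral_mono_ae (h0.mono fun x hx => ENNReal.ofReal_le_ofReal ?_)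
  exact mul_le_of_le_one_right hx (hη1 x)

end Mass

/-! ### The estimate for distributional solutions -/

section Distributional

variable {N : ℕ} {E : Set (Sp N)} {T : ℝ} {u : Sp N → ℝ → ℝ} {y : Sp N} {ρ s t p : ℝ}

theorem Lam_nonneg (u : Sp N → ℝ → ℝ) (y : Sp N) (ρ s t q : ℝ) : 0 ≤ Lam u y ρ s t q :=
  ENNReal.toReal_nonneg

/-- Product test functions `η(x) χ(t)` and Fubini: the weak time derivative of `∫ u η` is `∫ ln u
Δη`. -/
theorem IsDistributionalSolution.weak_deriv (hE : IsOpen E) (hu : IsDistributionalSolution E T u)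
    (hρ : 0 < ρ) (hst : s < t) (h : cube y (2 * ρ) ×ˢ Icc s t ⊆ cyl E T)
    {η : Sp N → ℝ} (hη : ContDiff ℝ ∞ η) (hηc : HasCompactSupport η)
    (hηK : tsupport η ⊆ cube y (2 * ρ)) :
    IntegrableOn (fun τ => ∫ x in cube y (2 * ρ), u x τ * η x) (Ioo s t) volume ∧
    IntegrableOn (fun τ => ∫ x in cube y (2 * ρ),
      Real.log (u x τ) * Laplacian.laplacian η x) (Ioo s t) volume ∧
    ∀ χ : ℝ → ℝ, ContDiff ℝ ∞ χ → HasCompactSupport χ → tsupport χ ⊆ Ioo s t →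
      ∫ τ in Ioo s t, ((∫ x in cube y (2 * ρ), u x τ * η x) * deriv χ τ +
        (∫ x in cube y (2 * ρ), Real.log (u x τ) * Laplacian.laplacian η x) * χ τ) = 0 := by
  set K := cube y (2 * ρ) with hK
  obtain ⟨hs, htT, hKE⟩ := cyl_subset hρ hst h
  have hKc : IsCompact K := isCompact_cube _ _
  set μ := (volume.restrict K).prod (volume.restrict (Ioo s t)) with hμ
  have hle : μ ≤ volume.restrict (K ×ˢ Icc s t) := by
    rw [hμ, ← restrict_prod_eq]
    exact Measure.restrict_mono (prod_mono_right Ioo_subset_Icc_self) le_rfl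
  have hui : Integrable (fun z : Sp N × ℝ => u z.1 z.2) μ :=
    (memLp_one_iff_integrable.1 (hu.memLp _ isCompact_closedCylinder h)).mono_measure hle
  have hli : Integrable (fun z : Sp N × ℝ => Real.log (u z.1 z.2)) μ :=
    (memLp_one_iff_integrable.1 (hu.memLp_log _ isCompact_closedCylinder h)).mono_measure hle
  have hmul : ∀ {g : Sp N × ℝ → ℝ} {k : Sp N × ℝ → ℝ}, Integrable g μ → Continuous k →
      (∃ C, ∀ z, ‖k z‖ ≤ C) → Integrable (fun z => g z * k z) μ := by
    rintro g k hg hk ⟨C, hC⟩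
    exact hg.mul_bdd hk.aestronglyMeasurable (ae_of_all _ hC)
  have hΔc := continuous_laplacian hη
  obtain ⟨A, hA⟩ := hηc.exists_bound_of_continuous hη.continuous
  obtain ⟨A', hA'⟩ := (hasCompactSupport_laplacian hηc).exists_bound_of_continuous hΔc
  have i1 : Integrable (fun z : Sp N × ℝ => u z.1 z.2 * η z.1) μ :=
    hmul hui (hη.continuous.comp continuous_fst) ⟨A, fun z => hA _⟩
  have i2 : Integrable (fun z : Sp N × ℝ => Real.log (u z.1 z.2) * Laplacian.laplacian η z.1) μ :=
    hmul hli (hΔc.comp continuous_fst) ⟨A', fun z => hA' _⟩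
  refine ⟨i1.integral_prod_right, i2.integral_prod_right, fun χ hχ hχc hχs => ?_⟩
  have hdχ : Continuous (deriv χ) := hχ.continuous_deriv (by simp)
  obtain ⟨B, hB⟩ := hχc.exists_bound_of_continuous hχ.continuous
  obtain ⟨B', hB'⟩ := hχc.deriv.exists_bound_of_continuous hdχ
  have j1 : Integrable (fun z : Sp N × ℝ => u z.1 z.2 * η z.1 * deriv χ z.2) μ :=
    hmul i1 (hdχ.comp continuous_snd) ⟨B', fun z => hB' _⟩
  have j2 : Integrable (fun z : Sp N × ℝ =>
      Real.log (u z.1 z.2) * Laplacian.laplacian η z.1 * χ z.2) μ :=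
    hmul i2 (hχ.continuous.comp continuous_snd) ⟨B, fun z => hB _⟩
  set φ : Sp N × ℝ → ℝ := fun z => η z.1 * χ z.2 with hφ
  have hsub : tsupport φ ⊆ tsupport η ×ˢ tsupport χ := by
    refine closure_minimal (fun z hz => ?_) ((isClosed_tsupport _).prod (isClosed_tsupport _))
    exact ⟨subset_tsupport _ (left_ne_zero_of_mul hz), subset_tsupport _ (right_ne_zero_of_mul hz)⟩
  have hφs : ContDiff ℝ ∞ φ := (hη.comp contDiff_fst).mul (hχ.comp contDiff_snd)
  have hφc : HasCompactSupport φ :=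
    (hηc.isCompact.prod hχc.isCompact).of_isClosed_subset (isClosed_tsupport _) hsub
  have hIoo : Ioo s t ⊆ Ioo 0 T := Ioo_subset_Ioo hs.le htT
  have heq := hu.equation φ hφs hφc
    (hsub.trans (prod_mono (hηK.trans hKE) (hχs.trans hIoo)))
  have hpt : ∀ z : Sp N × ℝ, u z.1 z.2 * deriv (fun τ => φ (z.1, τ)) z.2 +
      Real.log (u z.1 z.2) * Laplacian.laplacian (fun x => φ (x, z.2)) z.1 =
      u z.1 z.2 * η z.1 * deriv χ z.2 +
      Real.log (u z.1 z.2) * Laplacian.laplacian η z.1 * χ z.2 := by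
    intro z
    have e1 : deriv (fun τ => φ (z.1, τ)) z.2 = η z.1 * deriv χ z.2 := by
      simp only [hφ]
      exact deriv_const_mul _ (hχ.differentiable (by simp) _)
    have e2 : Laplacian.laplacian (fun x => φ (x, z.2)) z.1 =
        χ z.2 * Laplacian.laplacian η z.1 := by
      have h1 : (fun x => φ (x, z.2)) = χ z.2 • η := by
        ext x; simp [hφ, mul_comm]
      rw [h1, InnerProductSpace.laplacian_smul _
        (contDiff_infty.1 hη 2).contDiffAt, smul_eq_mul]
    rw [e1, e2]; ring
  simp only [hpt] at heq
  have hKE' : K ×ˢ Ioo s t ⊆ E ×ˢ Ioo 0 T := prod_mono hKE hIoo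
  rw [setIntegral_eq_of_subset_of_forall_sdiff_eq_zero (hE.measurableSet.prod measurableSet_Ioo)
    hKE', restrict_prod_eq, integral_prod_symm _ (by exact j1.add j2)] at heq
  · rw [← heq]
    refine integral_congr_ae ?_
    filter_upwards [j1.prod_left_ae, j2.prod_left_ae] with τ k1 k2
    rw [integral_add k1 k2, integral_mul_const, integral_mul_const]
  · rintro ⟨x, τ⟩ ⟨-, hz⟩
    by_cases hx : x ∈ K
    · have hτ : τ ∉ tsupport χ := fun hτ => hz ⟨hx, hχs hτ⟩
      have hτ' : τ ∉ tsupport (deriv χ) := fun h => hτ (tsupport_deriv_subset h)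
      simp [image_eq_zero_of_notMem_tsupport hτ, image_eq_zero_of_notMem_tsupport hτ']
    · have hx' : x ∉ tsupport η := fun h => hx (hηK h)
      simp [image_eq_zero_of_notMem_tsupport hx', laplacian_eq_zero_of_notMem hx']

theorem ae_integral_abs_log_le (hρ : 0 < ρ) (hst : s < t)
    (h : cube y (2 * ρ) ×ˢ Icc s t ⊆ cyl E T)
    (hu : NonnegLogFinite E T u) (hb : MemLpLoc E T u ⊤)
    (hlog : MemLinftyLpLoc E T (fun x τ => Real.log (u x τ)) p) {q : ℝ} (hq : 1 ≤ q)
    (hqp : q ≤ p) :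
    ∀ᵐ τ ∂(volume.restrict (Icc s t)),
      Integrable (fun x => Real.log (u x τ / supM u y ρ s t)) (volume.restrict (cube y (2 * ρ))) ∧
      ∫ x in cube y (2 * ρ), |Real.log (u x τ / supM u y ρ s t)| ≤
        (2 * ρ) ^ N * Lam u y ρ s t q := by
  set K := cube y (2 * ρ) with hK
  have hv0 : volume K ≠ 0 := volume_cube_ne_zero y (by linarith)
  have hv1 : volume K ≠ ⊤ := volume_cube_ne_top y _
  have hprob := isProbabilityMeasure_normalizedVolume hv0 hv1
  have hac : volume.restrict K ≪ normalizedVolume K :=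
    Measure.absolutelyContinuous_smul (by simpa using hv1)
  have hΛ := Lam_nonneg u y ρ s t q
  filter_upwards [ae_eLpNorm_le_Lam hρ hst h hu hb hlog hq hqp] with τ hτ
  have hm := hτ.1.mono_ac hac
  have hle : ∫⁻ x in K, ‖Real.log (u x τ / supM u y ρ s t)‖ₑ ≤
      ENNReal.ofReal ((2 * ρ) ^ N * Lam u y ρ s t q) := by
    rw [lintegral_eq_mul_normalizedVolume hv0 hv1, ← eLpNorm_one_eq_lintegral_enorm,
      ENNReal.ofReal_mul (by positivity), ENNReal.ofReal_pow (by positivity), ← volume_cube y]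
    refine mul_le_mul' le_rfl (le_trans ?_ hτ.2.2)
    exact eLpNorm_le_eLpNorm_of_exponent_le (by simpa using hq) hτ.1
  refine ⟨⟨hm, hle.trans_lt ENNReal.ofReal_lt_top⟩, ?_⟩
  simp only [← Real.norm_eq_abs]
  rw [integral_norm_eq_lintegral_enorm hm]
  exact ENNReal.toReal_le_of_le_ofReal (by positivity) hle

/-- Two derivatives of the cutoff cost `ρ⁻²` and the volume of the cube gives `ρ^N`; this is the
origin of the exponent `2 - N`. -/
theorem scaled_error_eq {ρ : ℝ} (hρ : 0 < ρ) (C a d : ℝ) (N : ℕ) :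
    C / ρ ^ 2 * ((2 * ρ) ^ N * a) * d = C * 2 ^ N * a * (d / ρ ^ (2 - (N : ℝ))) := by
  rw [Real.rpow_sub hρ, Real.rpow_natCast, Real.rpow_ofNat, mul_pow]
  field_simp

theorem IsDistributionalSolution.ae_mass_le (hE : IsOpen E) (hu : IsDistributionalSolution E T u)
    (hb : MemLpLoc E T u ⊤) (hlog : MemLinftyLpLoc E T (fun x τ => Real.log (u x τ)) p)
    (hp : 1 < p) (hρ : 0 < ρ) (hst : s < t) (h : cube y (2 * ρ) ×ˢ Icc s t ⊆ cyl E T)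
    {C : ℝ} (hC : 0 < C) {η : Sp N → ℝ} (hη : ContDiff ℝ ∞ η) (hηc : HasCompactSupport η)
    (hηK : tsupport η ⊆ cube y (2 * ρ)) (hη01 : ∀ x, 0 ≤ η x ∧ η x ≤ 1)
    (hη1 : ∀ x ∈ cube y ρ, η x = 1) (hΔ : ∀ x, |Laplacian.laplacian η x| ≤ C / ρ ^ 2) :
    ∀ᵐ a ∂(volume.restrict (Ioo s t)), ∀ᵐ b ∂(volume.restrict (Ioo s t)),
      mass u y ρ a ≤ mass u y (2 * ρ) b +
        ENNReal.ofReal (C * 2 ^ N * Lam u y ρ s t p * ((t - s) / ρ ^ (2 - (N : ℝ)))) := by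
  obtain ⟨hm, hL, hw⟩ := hu.weak_deriv hE hρ hst h hη hηc hηK
  set K := cube y (2 * ρ) with hK
  set M := supM u y ρ s t with hM
  have hsub : Ioo s t ⊆ Icc s t := Ioo_subset_Icc_self
  have hKint : ∀ c : ℝ, ∫ x in K, c * Laplacian.laplacian η x = 0 := fun c => by
    rw [integral_const_mul, setIntegral_eq_integral_of_forall_compl_eq_zero, integral_laplacian hη
      hηc, mul_zero]
    exact fun x hx => laplacian_eq_zero_of_notMem fun h' => hx (hηK h')
  have hLB : ∀ᵐ τ ∂(volume.restrict (Ioo s t)),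
      |∫ x in K, Real.log (u x τ) * Laplacian.laplacian η x| ≤
        C / ρ ^ 2 * ((2 * ρ) ^ N * Lam u y ρ s t p) := by
    filter_upwards [ae_restrict_of_ae_restrict_of_subset hsub
      (ae_integral_abs_log_le hρ hst h hu.nonnegLogFinite hb hlog hp.le le_rfl),
      ae_restrict_of_ae_restrict_of_subset hsub
      (ae_eLpNorm_le_Lam hρ hst h hu.nonnegLogFinite hb hlog hp.le le_rfl)] with τ h1 h2
    have hcΔ := continuous_laplacian hη
    have i1 : Integrable (fun x => Real.log (u x τ / M) * Laplacian.laplacian η x)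
        (volume.restrict K) := h1.1.mul_bdd hcΔ.aestronglyMeasurable (ae_of_all _ hΔ)
    have i2 : Integrable (fun x => Real.log M * Laplacian.laplacian η x) (volume.restrict K) :=
      ((hcΔ.integrable_of_hasCompactSupport (hasCompactSupport_laplacian hηc)).const_mul
        _).integrableOn
    -- `Δη` has mean zero, so the constant `ln M` may be subtracted; only `ln(u / M)` is controlled
    -- by `Λ_p`.
    have e : ∫ x in K, Real.log (u x τ) * Laplacian.laplacian η x =
        ∫ x in K, Real.log (u x τ / M) * Laplacian.laplacian η x := by
      rw [← add_zero (∫ x in K, Real.log (u x τ / M) * Laplacian.laplacian η x),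
        ← hKint (Real.log M), ← integral_add i1 i2]
      refine integral_congr_ae ?_
      filter_upwards [h2.2.1] with x hx
      rw [hx.2]; ring
    rw [e, ← Real.norm_eq_abs]
    refine (norm_integral_le_of_norm_le (h1.1.abs.const_mul (C / ρ ^ 2))
      (ae_of_all _ fun x => ?_)).trans ?_
    · rw [norm_mul, mul_comm]
      exact mul_le_mul_of_nonneg_right (hΔ x) (norm_nonneg _)
    · rw [integral_const_mul]
      exact mul_le_mul_of_nonneg_left h1.2 (by positivity)
  have hint : ∀ᵐ τ ∂(volume.restrict (Ioo s t)),
      Integrable (fun x => u x τ * η x) (volume.restrict K) ∧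
      ∀ᵐ x ∂(volume.restrict K), 0 ≤ u x τ := by
    have hui := memLp_one_iff_integrable.1 (hu.memLp _ isCompact_closedCylinder h)
    rw [restrict_prod_eq] at hui
    filter_upwards [ae_restrict_of_ae_restrict_of_subset hsub hui.prod_left_ae,
      ae_restrict_of_ae_restrict_of_subset hsub
      (ae_prod_swap (hu.nonnegLogFinite.ae_pos h))] with τ h1 h2
    refine ⟨h1.mul_bdd (c := 1) hη.continuous.aestronglyMeasurable (ae_of_all _ fun x => ?_),
      h2.mono fun x hx => hx.le⟩
    rw [Real.norm_of_nonneg (hη01 x).1]; exact (hη01 x).2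
  filter_upwards [ae_abs_sub_le_of_weak_deriv hm hL hLB hw, hint] with a ha hia
  filter_upwards [ha, hint] with b hb' hib
  rw [scaled_error_eq hρ] at hb'
  calc mass u y ρ a ≤ ENNReal.ofReal (∫ x in K, u x a * η x) :=
        mass_le_ofReal hρ hia.2 hia.1 (fun x => (hη01 x).1) hη1
    _ ≤ ENNReal.ofReal ((∫ x in K, u x b * η x) +
          C * 2 ^ N * Lam u y ρ s t p * ((t - s) / ρ ^ (2 - (N : ℝ)))) :=
        ENNReal.ofReal_le_ofReal (by linarith [(abs_le.1 hb').2])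
    _ ≤ _ := ENNReal.ofReal_add_le.trans (add_le_add
        (ofReal_le_mass hib.1 hib.2 (fun x => (hη01 x).1) fun x => (hη01 x).2) le_rfl)

end Distributional

/-! ### From solutions on a cylinder to the abstract weak data -/

section Quasilinear

variable {N : ℕ} {E : Set (Sp N)} {T : ℝ} {u : Sp N → ℝ → ℝ} {y : Sp N} {ρ s t p : ℝ}

/-- The sign condition in space-time concerns almost every time only, while the supremum and infimum
run over all times. Good times are dense, the negative part of `u(τ)` is at most `|u(σ) - u(τ)|` at
a good time `σ`, and L² continuity makes this arbitrarily small. -/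
theorem nonneg_of_memCLoc (hu : NonnegLogFinite E T u) (hC : MemCLoc E T u) (hρ : 0 < ρ)
    (hst : s < t) (h : cube y (2 * ρ) ×ˢ Icc s t ⊆ cyl E T) {τ : ℝ} (hτ : τ ∈ Ioo s t) :
    ∀ᵐ x ∂(volume.restrict (cube y (2 * ρ))), 0 ≤ u x τ := by
  obtain ⟨hs, htT, hKE⟩ := cyl_subset hρ hst h
  set K := cube y (2 * ρ) with hK
  obtain ⟨hL, hlim⟩ := hC K (isCompact_cube _ _) hKE
  have hτ' : τ ∈ Ioc 0 T := ⟨hs.trans hτ.1, hτ.2.le.trans htT⟩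
  have hae : ∀ᵐ σ ∂(volume.restrict (Ioo s t)), ∀ᵐ x ∂(volume.restrict K), 0 < u x σ :=
    ae_restrict_of_ae_restrict_of_subset Ioo_subset_Icc_self (ae_prod_swap (hu.ae_pos h))
  have hfreq : ∃ᶠ σ in 𝓝[Ioc 0 T] τ, ∀ᵐ x ∂(volume.restrict K), 0 < u x σ := by
    rw [ae_restrict_iff' measurableSet_Ioo] at hae
    have hd := Measure.dense_of_ae hae
    have hI : Ioo s t ∈ 𝓝 τ := isOpen_Ioo.mem_nhds hτ
    have hT : Ioc 0 T ∈ 𝓝 τ :=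
      mem_of_superset hI fun σ hσ => ⟨hs.trans hσ.1, hσ.2.le.trans htT⟩
    rw [nhdsWithin_eq_nhds.2 hT]
    intro hne
    obtain ⟨σ, h1, h2, h3⟩ := hd.inter_nhds_nonempty (inter_mem hI hne)
    exact h3 (h1 h2)
  have hz : eLpNorm (fun x => max (-u x τ) 0) 2 (volume.restrict K) = 0 := by
    refine le_antisymm (ENNReal.le_of_forall_pos_le_add fun ε hε _ => ?_) zero_le
    obtain ⟨σ, h1, h2⟩ := (hfreq.and_eventually
      ((ENNReal.tendsto_nhds_zero.1 (hlim τ hτ')) ε (by exact_mod_cast hε))).exists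
    rw [zero_add]
    refine le_trans (eLpNorm_mono_ae ?_) h2
    filter_upwards [h1] with x hx
    rw [Real.norm_of_nonneg (le_max_right _ _), Real.norm_eq_abs]
    exact max_le (by linarith [le_abs_self (u x σ - u x τ)]) (abs_nonneg _)
  have hm := (hL τ hτ').1
  rw [eLpNorm_eq_zero_iff (by exact hm.neg.sup aestronglyMeasurable_const) (by norm_num)] at hz
  filter_upwards [hz] with x hx
  simp only [Pi.zero_apply] at hx
  linarith [le_max_left (-u x τ) 0]

theorem ae_integral_sq_log_le (hρ : 0 < ρ) (hst : s < t)
    (h : cube y (2 * ρ) ×ˢ Icc s t ⊆ cyl E T)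
    (hu : NonnegLogFinite E T u) (hb : MemLpLoc E T u ⊤)
    (hlog : MemLinftyLpLoc E T (fun x τ => Real.log (u x τ)) p) (hp : 2 ≤ p) :
    ∀ᵐ τ ∂(volume.restrict (Icc s t)),
      ∫ x in cube y (2 * ρ), (1 + (Real.log (u x τ) - Real.log (supM u y ρ s t)) ^ 2) ≤
        (2 * ρ) ^ N * (1 + Lam u y ρ s t 2 ^ 2) := by
  set K := cube y (2 * ρ) with hK
  have hv0 : volume K ≠ 0 := volume_cube_ne_zero y (by linarith)
  have hv1 : volume K ≠ ⊤ := volume_cube_ne_top y _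
  have hac : volume.restrict K ≪ normalizedVolume K :=
    Measure.absolutelyContinuous_smul (by simpa using hv1)
  have hΛ := Lam_nonneg u y ρ s t 2
  have hfin : IsFiniteMeasure (volume.restrict K) := ⟨by simpa using hv1.lt_top⟩
  filter_upwards [ae_eLpNorm_le_Lam hρ hst h hu hb hlog one_le_two hp] with τ hτ
  set g := fun x => Real.log (u x τ / supM u y ρ s t) with hg
  have hm : AEStronglyMeasurable g (volume.restrict K) := hτ.1.mono_ac hac
  have hle : ∫⁻ x in K, ‖g x‖ₑ ^ 2 ≤ ENNReal.ofReal ((2 * ρ) ^ N * Lam u y ρ s t 2 ^ 2) := by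
    rw [lintegral_eq_mul_normalizedVolume hv0 hv1, ← eLpNorm_two_sq,
      ENNReal.ofReal_mul (by positivity), ENNReal.ofReal_pow (by positivity),
      ENNReal.ofReal_pow hΛ, ← volume_cube y]
    refine mul_le_mul' le_rfl (pow_le_pow_left' ?_ 2)
    simpa using hτ.2.2
  have hL2 : MemLp g 2 (volume.restrict K) := by
    refine ⟨hm, ?_⟩
    rw [← eLpNorm_two_sq (volume.restrict K) g] at hle
    exact (ENNReal.pow_lt_top_iff.1 (hle.trans_lt ENNReal.ofReal_lt_top)).resolve_right (by norm_num)
  have hsq : ∫ x in K, g x ^ 2 ≤ (2 * ρ) ^ N * Lam u y ρ s t 2 ^ 2 := by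
    have h1 : ∫ x in K, g x ^ 2 = ∫ x in K, ‖g x ^ 2‖ :=
      integral_congr_ae (ae_of_all _ fun x => (Real.norm_of_nonneg (sq_nonneg _)).symm)
    rw [h1, integral_norm_eq_lintegral_enorm (by exact hm.pow 2)]
    simp only [enorm_pow]
    exact ENNReal.toReal_le_of_le_ofReal (by positivity) hle
  have e : ∫ x in K, (1 + (Real.log (u x τ) - Real.log (supM u y ρ s t)) ^ 2) =
      ∫ x in K, (1 + g x ^ 2) := by
    refine integral_congr_ae ?_
    filter_upwards [hτ.2.1] with x hx
    simp only [hg, hx.2]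
  rw [e, integral_add (integrable_const _) hL2.integrable_sq, mul_add]
  refine add_le_add ?_ hsq
  simp only [integral_const, smul_eq_mul, mul_one, Measure.real, Measure.restrict_apply_univ]
  rw [hK, volume_cube, ENNReal.toReal_pow, ENNReal.toReal_ofReal (by linarith)]

/-- The data of a solution, cut off outside a cylinder. -/
theorem weakData_of_cylinder {A : Sp N → ℝ → ℝ → Sp N → Sp N} {Co C₁ : ℝ}
    (hE : IsOpen E) (hA : StructureConditions E T A Co C₁)
    (hu : NonnegLogFinite E T u) {G : Sp N → ℝ → Sp N}
    (hG : MemL2W12Loc E T (fun x τ => Real.log (u x τ)) G)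
    (heq : WeakEquation E T u (fun x τ => A x τ (u x τ) (u x τ • G x τ)))
    (hb : MemLpLoc E T u ⊤) (hρ : 0 < ρ) (hst : s < t)
    (h : cube y (2 * ρ) ×ˢ Icc s t ⊆ cyl E T) :
    (∀ᵐ z ∂((volume.restrict (cube y (2 * ρ))).prod (volume.restrict (Icc s t))),
      Co * ‖G z.1 z.2‖ ^ 2 ≤
        inner ℝ (A z.1 z.2 (u z.1 z.2) (u z.1 z.2 • G z.1 z.2)) (G z.1 z.2) ∧
      ‖A z.1 z.2 (u z.1 z.2) (u z.1 z.2 • G z.1 z.2)‖ ≤ C₁ * ‖G z.1 z.2‖) ∧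
    WeakData (cube y (2 * ρ)) s t
      ((cube y (2 * ρ) ×ˢ Icc s t).indicator fun z => u z.1 z.2)
      ((cube y (2 * ρ) ×ˢ Icc s t).indicator fun z => Real.log (u z.1 z.2))
      ((cube y (2 * ρ) ×ˢ Icc s t).indicator fun z =>
        A z.1 z.2 (u z.1 z.2) (u z.1 z.2 • G z.1 z.2))
      ((cube y (2 * ρ) ×ˢ Icc s t).indicator fun z => G z.1 z.2) := by
  obtain ⟨hs, htT, hKE⟩ := cyl_subset hρ hst h
  set K := cube y (2 * ρ) with hK
  set Q := K ×ˢ Icc s t with hQ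
  have hKc : IsCompact K := isCompact_cube _ _
  have hQc : IsCompact Q := isCompact_closedCylinder
  have hQm : MeasurableSet Q := hQc.isClosed.measurableSet
  have hfin : IsFiniteMeasure (volume.restrict Q) := ⟨by simpa using hQc.measure_lt_top⟩
  have hpos : ∀ᵐ z ∂(volume.restrict Q), 0 < u z.1 z.2 := by
    rw [restrict_prod_eq]; exact hu.ae_pos h
  have hstr : ∀ᵐ z ∂(volume.restrict Q), Co * ‖G z.1 z.2‖ ^ 2 ≤
      inner ℝ (A z.1 z.2 (u z.1 z.2) (u z.1 z.2 • G z.1 z.2)) (G z.1 z.2) ∧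
      ‖A z.1 z.2 (u z.1 z.2) (u z.1 z.2 • G z.1 z.2)‖ ≤ C₁ * ‖G z.1 z.2‖ := by
    filter_upwards [hpos, ae_restrict_of_ae_restrict_of_subset h hA.coercive,
      ae_restrict_of_ae_restrict_of_subset h hA.growth] with z h1 h2 h3
    -- With `ξ = u G` the powers of `u` cancel, and the degenerate structure conditions become
    -- uniform bounds in terms of `G = D ln u`.
    have h4 := h2 _ h1 (u z.1 z.2 • G z.1 z.2)
    have h5 := h3 _ h1 (u z.1 z.2 • G z.1 z.2)
    rw [norm_smul, Real.norm_of_nonneg h1.le] at h4 h5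
    rw [inner_smul_right, mul_pow, sq (u z.1 z.2), mul_assoc, mul_div_cancel_left₀ _ h1.ne',
      mul_left_comm] at h4
    rw [mul_div_cancel_left₀ _ h1.ne'] at h5
    exact ⟨le_of_mul_le_mul_left h4 h1, h5⟩
  have hu2 : MemLp (fun z : Sp N × ℝ => u z.1 z.2) 2 (volume.restrict Q) :=
    (hb Q hQc h).mono_exponent le_top
  have hG2 := hG.memLp_grad Q hQc h
  have hF2 : MemLp (fun z : Sp N × ℝ => A z.1 z.2 (u z.1 z.2) (u z.1 z.2 • G z.1 z.2)) 2
      (volume.restrict Q) := by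
    refine hG2.of_le_mul (c := C₁) ?_ (hstr.mono fun z hz => hz.2)
    have h1 : AEMeasurable (fun z : Sp N × ℝ =>
        (z.1, z.2, u z.1 z.2, u z.1 z.2 • G z.1 z.2)) (volume.restrict Q) :=
      measurable_fst.aemeasurable.prodMk (measurable_snd.aemeasurable.prodMk
        (hu2.1.aemeasurable.prodMk (hu2.1.smul hG2.1).aemeasurable))
    exact (hA.measurable.comp_aemeasurable h1).aestronglyMeasurable
  have hgrad0 : ∀ {φ : Sp N → ℝ}, tsupport φ ⊆ K → ∀ x ∉ K, gradient φ x = 0 := by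
    intro φ hφ x hx
    have : x ∉ tsupport (fderiv ℝ φ) := fun h' => hx (hφ (tsupport_fderiv_subset ℝ h'))
    rw [← norm_eq_zero, norm_gradient, image_eq_zero_of_notMem_tsupport this, norm_zero]
  have hphi0 : ∀ {φ : Sp N → ℝ}, tsupport φ ⊆ K → ∀ x ∉ K, φ x = 0 := fun hφ x hx =>
    image_eq_zero_of_notMem_tsupport fun h' => hx (hφ h')
  refine ⟨by rw [← restrict_prod_eq]; exact hstr, ?_⟩
  refine ⟨(memLp_indicator_iff_restrict hQm).2 hu2,
    (memLp_indicator_iff_restrict hQm).2 (hG.memLp Q hQc h),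
    (memLp_indicator_iff_restrict hQm).2 hF2, (memLp_indicator_iff_restrict hQm).2 hG2,
    ?_, ?_, ?_⟩
  · have hsub : Ioc s t ⊆ Ioc 0 T := Ioc_subset_Ioc hs.le htT
    filter_upwards [ae_restrict_of_ae_restrict_of_subset hsub hG.weakGradient,
      ae_restrict_mem measurableSet_Ioc] with τ h1 h2 φ hφ hφc hφK
    have h3 := h1 φ hφ hφc (hφK.trans hKE)
    rw [setIntegral_eq_integral_of_forall_compl_eq_zero (fun x hx => by
        rw [hgrad0 hφK x (fun h' => hx (hKE h')), smul_zero]),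
      setIntegral_eq_integral_of_forall_compl_eq_zero (fun x hx => by
        rw [hphi0 hφK x (fun h' => hx (hKE h')), zero_smul])] at h3
    have hmem : ∀ x ∈ K, (x, τ) ∈ Q := fun x hx => ⟨hx, h2.1.le, h2.2⟩
    calc _ = ∫ x, Real.log (u x τ) • gradient φ x := by
          refine integral_congr_ae (ae_of_all _ fun x => ?_)
          by_cases hx : x ∈ K
          · simp only [indicator_of_mem (hmem x hx)]
          · simp only [hgrad0 hφK x hx, smul_zero]
      _ = -∫ x, φ x • G x τ := h3
      _ = _ := by
          refine congrArg Neg.neg (integral_congr_ae (ae_of_all _ fun x => ?_))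
          by_cases hx : x ∈ K
          · simp only [indicator_of_mem (hmem x hx)]
          · simp only [hphi0 hφK x hx, zero_smul]
  · intro φ hφ hφc hφK t₁ t₂ h₁ h₁₂ h₂
    have hT0 : 0 < T := hs.trans (hst.trans_le htT)
    -- A test function of `x` alone has no compact support in time; this factor equals `1` near `[0,
    -- T]`, so it adds compactness and no time derivative.
    let b : ContDiffBump (0 : ℝ) := ⟨T + 1, T + 2, by linarith, by linarith⟩
    have hb1 : ∀ τ ∈ Icc 0 T, b τ = 1 := fun τ hτ => b.one_of_mem_closedBall (by
      rw [mem_closedBall_zero_iff, Real.norm_of_nonneg hτ.1]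
      change τ ≤ T + 1
      linarith [hτ.2])
    have hb2 : ∀ τ ∈ Icc 0 T, deriv b τ = 0 := fun τ hτ => by
      have : b =ᶠ[𝓝 τ] fun _ => 1 := b.eventuallyEq_one_of_mem_ball (by
        rw [mem_ball_zero_iff, Real.norm_of_nonneg hτ.1]
        change τ < T + 1
        linarith [hτ.2])
      rw [this.deriv_eq]; simp
    set ψ : Sp N × ℝ → ℝ := fun z => φ z.1 * b z.2 with hψ
    have hsub : tsupport ψ ⊆ tsupport φ ×ˢ tsupport b := by
      refine closure_minimal (fun z hz => ?_) ((isClosed_tsupport _).prod (isClosed_tsupport _))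
      exact ⟨subset_tsupport _ (left_ne_zero_of_mul hz),
        subset_tsupport _ (right_ne_zero_of_mul hz)⟩
    have hψc : HasCompactSupport ψ :=
      (hφc.isCompact.prod b.hasCompactSupport.isCompact).of_isClosed_subset
        (isClosed_tsupport _) hsub
    have h3 := heq ψ ((hφ.comp contDiff_fst).mul (b.contDiff.comp contDiff_snd)) hψc
      (hsub.trans (prod_mono (hφK.trans hKE) (subset_univ _))) t₁ t₂ (by linarith) h₁₂
      (by linarith)
    have hslice : ∀ τ ∈ Icc s t, ∫ x in E, u x τ * ψ (x, τ) =
        ∫ x, Q.indicator (fun z => u z.1 z.2) (x, τ) * φ x := by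
      intro τ hτ
      rw [setIntegral_eq_integral_of_forall_compl_eq_zero (fun x hx => by
        simp [hψ, hphi0 hφK x (fun h' => hx (hKE h'))])]
      refine integral_congr_ae (ae_of_all _ fun x => ?_)
      by_cases hx : x ∈ K
      · simp only [indicator_of_mem (show (x, τ) ∈ Q from ⟨hx, hτ⟩), hψ]
        rw [hb1 τ ⟨by linarith [hτ.1], by linarith [hτ.2]⟩, mul_one]
      · simp [hψ, hphi0 hφK x hx]
    rw [hslice t₂ ⟨by linarith, h₂⟩, hslice t₁ ⟨h₁, by linarith⟩] at h3
    rw [← h3]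
    congr 1
    have e1 : (volume : Measure (Sp N)).prod (volume.restrict (Ioc t₁ t₂)) =
        (volume : Measure (Sp N × ℝ)).restrict (univ ×ˢ Ioc t₁ t₂) := by
      rw [restrict_prod_eq, Measure.restrict_univ]
    rw [e1, setIntegral_eq_of_subset_of_forall_sdiff_eq_zero
      (MeasurableSet.univ.prod measurableSet_Ioc)
      (prod_mono_left (subset_univ E) : E ×ˢ Ioc t₁ t₂ ⊆ univ ×ˢ Ioc t₁ t₂)]
    · refine setIntegral_congr_fun (hE.measurableSet.prod measurableSet_Ioc) fun z hz => ?_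
      have hz2 : z.2 ∈ Icc 0 T := ⟨by linarith [hz.2.1], by linarith [hz.2.2]⟩
      have e2 : deriv (fun τ => ψ (z.1, τ)) z.2 = 0 := by
        simp only [hψ]
        rw [deriv_const_mul _ (b.contDiff.differentiable (n := 1) (by simp) _), hb2 _ hz2, mul_zero]
      have e3 : (fun x => ψ (x, z.2)) = φ := by
        ext x; simp only [hψ]; rw [hb1 _ hz2, mul_one]
      simp only [e2, e3, mul_zero, zero_add]
      by_cases hx : z.1 ∈ K
      · rw [indicator_of_mem (show z ∈ Q from ⟨hx, by linarith [hz.2.1], by linarith [hz.2.2]⟩)]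
      · rw [hgrad0 hφK _ hx, inner_zero_right, inner_zero_right]
    · rintro z ⟨hz1, hz2⟩
      have hx : z.1 ∉ E := fun h' => hz2 ⟨h', hz1.2⟩
      rw [hgrad0 hφK _ (fun h' => hx (hKE h')), inner_zero_right]
  · have hsub : K ×ˢ Ioc s t ⊆ Q := prod_mono_right Ioc_subset_Icc_self
    rw [← restrict_prod_eq]
    filter_upwards [ae_restrict_of_ae_restrict_of_subset hsub hpos,
      ae_restrict_mem (hKc.isClosed.measurableSet.prod measurableSet_Ioc)] with z h1 h2
    rw [indicator_of_mem (hsub h2), indicator_of_mem (hsub h2)]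
    exact ⟨h1, rfl⟩

end Quasilinear

/-! ### The estimates with explicit constants -/

section Main

variable {N : ℕ} {E : Set (Sp N)} {T : ℝ} {u : Sp N → ℝ → ℝ} {y : Sp N} {ρ s t p : ℝ}

/-- `WeakData.mass_le` with `l = ln M` and `B = C / ρ`. Centring at `ln M` makes the weight integral
`Y` at most `(2ρ)^N (1 + Λ₂²) (t - s)`. -/
theorem IsLocalWeakSolutionQuasilinear.mass_le {A : Sp N → ℝ → ℝ → Sp N → Sp N} {Co C₁ : ℝ}
    (hCo : 0 < Co) (hC₁ : 0 < C₁) (hE : IsOpen E) (hA : StructureConditions E T A Co C₁)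
    (hu : IsLocalWeakSolutionQuasilinear E T A u) (hb : MemLpLoc E T u ⊤)
    (hlog : MemLinftyLpLoc E T (fun x τ => Real.log (u x τ)) p) (hp : 2 ≤ p) (hρ : 0 < ρ)
    (hst : s < t) (h : cube y (2 * ρ) ×ˢ Icc s t ⊆ cyl E T)
    {C : ℝ} {η : Sp N → ℝ} (hη : ContDiff ℝ ∞ η) (hηc : HasCompactSupport η)
    (hηK : tsupport η ⊆ interior (cube y (2 * ρ))) (hη01 : ∀ x, 0 ≤ η x ∧ η x ≤ 1)
    (hη1 : ∀ x ∈ cube y ρ, η x = 1) (hgη : ∀ x, ‖gradient η x‖ ≤ C / ρ)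
    {a b : ℝ} (ha : a ∈ Ioo s t) (hb' : b ∈ Ioo s t) :
    mass u y ρ a ≤ ENNReal.ofReal (5 / 3) * mass u y (2 * ρ) b +
      ENNReal.ofReal (24 * C₁ ^ 2 / Co * C ^ 2 * 2 ^ N * (1 + Lam u y ρ s t 2 ^ 2) *
        ((t - s) / ρ ^ (2 - (N : ℝ)))) := by
  obtain ⟨G, hG, heq⟩ := hu.exists_grad
  obtain ⟨hs, htT, hKE⟩ := cyl_subset hρ hst h
  obtain ⟨hstr, D⟩ := weakData_of_cylinder hE hA hu.nonnegLogFinite hG heq hb hρ hst h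
  set K := cube y (2 * ρ) with hK
  set M := supM u y ρ s t with hM
  have hKc : IsCompact K := isCompact_cube _ _
  have hKm : MeasurableSet K := hKc.isClosed.measurableSet
  have hsub : K ×ˢ Ioc s t ⊆ K ×ˢ Icc s t := prod_mono_right Ioc_subset_Icc_self
  have hmem : ∀ᵐ z ∂((volume.restrict K).prod (volume.restrict (Ioc s t))), z ∈ K ×ˢ Icc s t := by
    rw [← restrict_prod_eq]
    exact (ae_restrict_mem (hKm.prod measurableSet_Ioc)).mono fun z hz => hsub hz
  have hF : ∀ᵐ z ∂((volume.restrict K).prod (volume.restrict (Ioc s t))),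
      Co * ‖(K ×ˢ Icc s t).indicator (fun z => G z.1 z.2) z‖ ^ 2 ≤
        inner ℝ ((K ×ˢ Icc s t).indicator
          (fun z => A z.1 z.2 (u z.1 z.2) (u z.1 z.2 • G z.1 z.2)) z)
          ((K ×ˢ Icc s t).indicator (fun z => G z.1 z.2) z) ∧
      ‖(K ×ˢ Icc s t).indicator (fun z => A z.1 z.2 (u z.1 z.2) (u z.1 z.2 • G z.1 z.2)) z‖ ≤
        C₁ * ‖(K ×ˢ Icc s t).indicator (fun z => G z.1 z.2) z‖ := by
    filter_upwards [ae_slab_mono Ioc_subset_Icc_self hstr, hmem] with z h1 h2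
    simpa only [indicator_of_mem h2] using h1
  have hY : ∫ z, (1 + ((K ×ˢ Icc s t).indicator (fun z => Real.log (u z.1 z.2)) z -
      Real.log M) ^ 2) ∂((volume.restrict K).prod (volume.restrict (Ioc s t))) ≤
      (2 * ρ) ^ N * (1 + Lam u y ρ s t 2 ^ 2) * (t - s) := by
    have hfin : IsFiniteMeasure (volume.restrict K) := ⟨by simpa using hKc.measure_lt_top⟩
    have hint : Integrable (fun z : Sp N × ℝ => 1 + (Real.log (u z.1 z.2) - Real.log M) ^ 2)
        ((volume.restrict K).prod (volume.restrict (Ioc s t))) := by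
      have hl := (hG.memLp _ isCompact_closedCylinder h).mono_measure
        (Measure.restrict_mono hsub le_rfl)
      rw [restrict_prod_eq] at hl
      exact (integrable_const _).add (hl.sub (memLp_const _)).integrable_sq
    have e : ∫ z, (1 + ((K ×ˢ Icc s t).indicator (fun z => Real.log (u z.1 z.2)) z -
        Real.log M) ^ 2) ∂((volume.restrict K).prod (volume.restrict (Ioc s t))) =
        ∫ z : Sp N × ℝ, (1 + (Real.log (u z.1 z.2) - Real.log M) ^ 2)
          ∂((volume.restrict K).prod (volume.restrict (Ioc s t))) :=
      integral_congr_ae (hmem.mono fun z hz => by simp only [indicator_of_mem hz])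
    rw [e, integral_prod_symm _ hint]
    refine (integral_mono_ae hint.integral_prod_right (integrable_const _)
      (ae_restrict_of_ae_restrict_of_subset Ioc_subset_Icc_self
        (ae_integral_sq_log_le hρ hst h hu.nonnegLogFinite hb hlog hp))).trans_eq ?_
    simp [Measure.real, hst.le, mul_comm]
  have key := D.mass_le hKc hst hCo hC₁ hF hη hηc hηK (fun x => (hη01 x).1) hgη hY
    (Ioo_subset_Icc_self ha) (Ioo_subset_Icc_self hb')
  have hslice : ∀ τ ∈ Ioo s t, ∫ x, (K ×ˢ Icc s t).indicator (fun z => u z.1 z.2) (x, τ) *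
      (η x * η x) = ∫ x in K, u x τ * (η x * η x) := by
    intro τ hτ
    rw [← integral_indicator hKm]
    refine integral_congr_ae (ae_of_all _ fun x => ?_)
    by_cases hx : x ∈ K
    · simp only [indicator_of_mem hx,
        indicator_of_mem (show (x, τ) ∈ K ×ˢ Icc s t from ⟨hx, Ioo_subset_Icc_self hτ⟩)]
    · simp only [indicator_of_notMem hx,
        indicator_of_notMem (show (x, τ) ∉ K ×ˢ Icc s t from fun h' => hx h'.1), zero_mul]
  rw [hslice a ha, hslice b hb'] at key
  have hη2 : ∀ x, 0 ≤ η x * η x := fun x => mul_self_nonneg _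
  have hη2' : ∀ x, η x * η x ≤ 1 := fun x => mul_le_one₀ (hη01 x).2 (hη01 x).1 (hη01 x).2
  have hint : ∀ τ ∈ Ioo s t, Integrable (fun x => u x τ * (η x * η x)) (volume.restrict K) := by
    intro τ hτ
    have hL := (hu.memCLoc K hKc hKE).1 τ ⟨hs.trans hτ.1, hτ.2.le.trans htT⟩
    have hfin : IsFiniteMeasure (volume.restrict K) := ⟨by simpa using hKc.measure_lt_top⟩
    refine (hL.integrable (by norm_num)).mul_bdd (c := 1)
      (hη.continuous.mul hη.continuous).aestronglyMeasurable (ae_of_all _ fun x => ?_)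
    rw [Real.norm_of_nonneg (hη2 x)]
    exact hη2' x
  have hnn := fun τ (hτ : τ ∈ Ioo s t) =>
    nonneg_of_memCLoc hu.nonnegLogFinite hu.memCLoc hρ hst h hτ
  have herr : 24 * C₁ ^ 2 / Co * ((C / ρ) ^ 2 * ((2 * ρ) ^ N * (1 + Lam u y ρ s t 2 ^ 2) *
      (t - s))) = 24 * C₁ ^ 2 / Co * C ^ 2 * 2 ^ N * (1 + Lam u y ρ s t 2 ^ 2) *
        ((t - s) / ρ ^ (2 - (N : ℝ))) := by
    rw [← scaled_error_eq hρ, div_pow]; ring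
  rw [herr] at key
  calc mass u y ρ a ≤ ENNReal.ofReal (∫ x in K, u x a * (η x * η x)) :=
        mass_le_ofReal hρ (hnn a ha) (hint a ha) hη2 fun x hx => by rw [hη1 x hx, mul_one]
    _ ≤ _ := ENNReal.ofReal_le_ofReal key
    _ ≤ _ := ENNReal.ofReal_add_le
    _ ≤ _ := by
        rw [ENNReal.ofReal_mul (by norm_num)]
        exact add_le_add (mul_le_mul' le_rfl
          (ofReal_le_mass (hint b hb') (hnn b hb') hη2 hη2')) le_rfl

/-- For this field `A(x, t, u, u G) = G` wherever `u ≠ 0`, which brings the model equation under the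
quasilinear case with both constants `1`. -/
theorem structureConditions_inv_smul (E : Set (Sp N)) (T : ℝ) :
    StructureConditions E T (fun _ _ v ξ => v⁻¹ • ξ) 1 1 where
  measurable := by fun_prop
  coercive := ae_of_all _ fun z v hv ξ => by
    rw [inner_smul_left, real_inner_self_eq_norm_sq, one_mul, div_eq_inv_mul]
    rfl
  growth := ae_of_all _ fun z v hv ξ => by
    rw [norm_smul, norm_inv, Real.norm_of_nonneg hv.le, one_mul, div_eq_inv_mul]

/-- Solutions of `u_t = Δ log u` are solutions of a quasilinear equation. -/
theorem IsLocalWeakSolution.quasilinear (hu : IsLocalWeakSolution E T u) :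
    IsLocalWeakSolutionQuasilinear E T (fun _ _ v ξ => v⁻¹ • ξ) u := by
  obtain ⟨G, hG, heq⟩ := hu.exists_grad
  refine ⟨hu.nonnegLogFinite, hu.memCLoc, G, hG, fun φ h1 h2 h3 t₁ t₂ h4 h5 h6 => ?_⟩
  rw [← heq φ h1 h2 h3 t₁ t₂ h4 h5 h6]
  congr 1
  refine integral_congr_ae ?_
  have hsub : E ×ˢ Ioc t₁ t₂ ⊆ cyl E T := prod_mono_right (Ioc_subset_Ioc h4.le h6)
  filter_upwards [ae_restrict_of_ae_restrict_of_subset hsub hu.nonnegLogFinite.ne_zero] with z hz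
  rw [inv_smul_smul₀ hz]

theorem iSup_mass_le {γ c e d : ℝ} (hγ : 0 < γ) (hc : c ≤ γ) (hd : 0 ≤ d) (he : e ≤ γ)
    (h : ∀ a ∈ Ioo s t, ∀ b ∈ Ioo s t, mass u y ρ a ≤
      ENNReal.ofReal c * mass u y (2 * ρ) b + ENNReal.ofReal (e * d)) :
    (⨆ τ ∈ Ioo s t, mass u y ρ τ) ≤ ENNReal.ofReal γ *
      ((⨅ τ ∈ Ioo s t, mass u y (2 * ρ) τ) + ENNReal.ofReal d) := by
  refine iSup₂_le fun a ha => ?_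
  have h0 : ENNReal.ofReal γ ≠ 0 := by simpa using hγ
  -- The error is moved to the left by truncated subtraction in `[0, ∞]`, so that the infimum can be
  -- taken term by term.
  rw [mul_add, ← ENNReal.ofReal_mul hγ.le, ← tsub_le_iff_right,
    ENNReal.mul_iInf_of_ne h0 ENNReal.ofReal_ne_top]
  refine le_iInf fun b => ?_
  rw [ENNReal.mul_iInf_of_ne h0 ENNReal.ofReal_ne_top]
  refine le_iInf fun hb => tsub_le_iff_right.2 ((h a ha b hb).trans ?_)
  exact add_le_add (mul_le_mul' (ENNReal.ofReal_le_ofReal hc) le_rfl)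
    (ENNReal.ofReal_le_ofReal (mul_le_mul_of_nonneg_right he hd))

theorem essSup_mass_le {γ e d : ℝ} (hγ : 1 ≤ γ) (hd : 0 ≤ d) (he : e ≤ γ)
    (h : ∀ᵐ a ∂(volume.restrict (Ioo s t)), ∀ᵐ b ∂(volume.restrict (Ioo s t)),
      mass u y ρ a ≤ mass u y (2 * ρ) b + ENNReal.ofReal (e * d)) :
    essSup (fun τ => mass u y ρ τ) (volume.restrict (Ioo s t)) ≤ ENNReal.ofReal γ *
      (essInf (fun τ => mass u y (2 * ρ) τ) (volume.restrict (Ioo s t)) + ENNReal.ofReal d) := by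
  refine essSup_le_of_ae_le _ (h.mono fun a ha => ?_)
  have h1 : mass u y ρ a - ENNReal.ofReal (e * d) ≤
      essInf (fun τ => mass u y (2 * ρ) τ) (volume.restrict (Ioo s t)) :=
    le_essInf_of_ae_le _ (ha.mono fun b hb => tsub_le_iff_right.2 hb)
  refine (tsub_le_iff_right.1 h1).trans ?_
  rw [mul_add, ← ENNReal.ofReal_mul (zero_le_one.trans hγ)]
  exact add_le_add (le_mul_of_one_le_left' (by simpa using hγ))
    (ENNReal.ofReal_le_ofReal (mul_le_mul_of_nonneg_right he hd))

theorem exists_gamma_quasilinear (N : ℕ) {p Co C₁ : ℝ} (hp : 2 ≤ p) (hCo : 0 < Co)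
    (hC₁ : 0 < C₁) :
    ∃ γ : ℝ → ℝ → ℝ, (∀ a b, 0 < γ a b) ∧
      ∀ (E : Set (Sp N)) (T : ℝ) (A : Sp N → ℝ → ℝ → Sp N → Sp N) (u : Sp N → ℝ → ℝ),
        IsOpen E → StructureConditions E T A Co C₁ → IsLocalWeakSolutionQuasilinear E T A u →
        MemLpLoc E T u ⊤ → MemLinftyLpLoc E T (fun x τ => Real.log (u x τ)) p →
        ∀ (y : Sp N) (ρ s t : ℝ), 0 < ρ → s < t → cube y (2 * ρ) ×ˢ Icc s t ⊆ cyl E T →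
          (⨆ τ ∈ Ioo s t, mass u y ρ τ) ≤
            ENNReal.ofReal (γ (Lam u y ρ s t 1) (Lam u y ρ s t 2)) *
              ((⨅ τ ∈ Ioo s t, mass u y (2 * ρ) τ) +
                ENNReal.ofReal ((t - s) / ρ ^ (2 - (N : ℝ)))) := by
  obtain ⟨C, hC, hcut⟩ := exists_cutoff N
  have hpos : ∀ b : ℝ, 0 ≤ 24 * C₁ ^ 2 / Co * C ^ 2 * 2 ^ N * (1 + b ^ 2) := fun b => by
    positivity
  -- The summand `2` exceeds `5 / 3` and keeps the constant positive.
  refine ⟨fun _ b => 2 + 24 * C₁ ^ 2 / Co * C ^ 2 * 2 ^ N * (1 + b ^ 2), fun _ b => ?_, ?_⟩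
  · linarith [hpos b]
  · intro E T A u hE hA hu hb hlog y ρ s t hρ hst h
    obtain ⟨η, hη, hηc, hηK, hη01, hη1, hgη, -⟩ := hcut y ρ hρ
    have := hpos (Lam u y ρ s t 2)
    exact iSup_mass_le (by linarith) (by linarith)
      (div_nonneg (sub_nonneg.2 hst.le) (Real.rpow_nonneg hρ.le _))
      (by linarith) fun a ha b hb' => hu.mass_le hCo hC₁ hE hA hb hlog hp hρ hst h hη hηc hηK hη01
        hη1 hgη ha hb'

end Main
end LogDiffusion

theorem proposition2p1 :
    -- weak solutions of `u_t - Δ ln u = 0`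
    (∀ (N : ℕ) (r p : ℝ), 1 ≤ N → max 1 ((N : ℝ) / 2) < r → 2 ≤ p →
      ∃ γ : ℝ → ℝ → ℝ, (∀ a b, 0 < γ a b) ∧
        ∀ (E : Set (LogDiffusion.Sp N)) (T : ℝ) (u : LogDiffusion.Sp N → ℝ → ℝ),
          IsOpen E → 0 < T →
          LogDiffusion.IsLocalWeakSolution E T u →
          LogDiffusion.MemLpLoc E T u ⊤ →
          LogDiffusion.MemLpLoc E T u (ENNReal.ofReal r) →
          LogDiffusion.MemLinftyLpLoc E T (fun x τ => Real.log (u x τ)) p →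
          ∀ (y : LogDiffusion.Sp N) (ρ s t : ℝ), 0 < ρ → s < t →
            LogDiffusion.cube y (2 * ρ) ×ˢ Set.Icc s t ⊆ LogDiffusion.cyl E T →
            (⨆ τ ∈ Set.Ioo s t, LogDiffusion.mass u y ρ τ) ≤
              ENNReal.ofReal
                  (γ (LogDiffusion.Lam u y ρ s t 1) (LogDiffusion.Lam u y ρ s t 2)) *
                ((⨅ τ ∈ Set.Ioo s t, LogDiffusion.mass u y (2 * ρ) τ) +
                  ENNReal.ofReal ((t - s) / ρ ^ (2 - (N : ℝ))))) ∧
    -- weak solutions of `u_t - div A(x, t, u, Du) = 0`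
    (∀ (N : ℕ) (r p Co C1 : ℝ), 1 ≤ N → max 1 ((N : ℝ) / 2) < r → 2 ≤ p → 0 < Co → 0 < C1 →
      ∃ γ : ℝ → ℝ → ℝ, (∀ a b, 0 < γ a b) ∧
        ∀ (E : Set (LogDiffusion.Sp N)) (T : ℝ)
          (A : LogDiffusion.Sp N → ℝ → ℝ → LogDiffusion.Sp N → LogDiffusion.Sp N)
          (u : LogDiffusion.Sp N → ℝ → ℝ),
          IsOpen E → 0 < T →
          LogDiffusion.StructureConditions E T A Co C1 →
          LogDiffusion.IsLocalWeakSolutionQuasilinear E T A u →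
          LogDiffusion.MemLpLoc E T u ⊤ →
          LogDiffusion.MemLpLoc E T u (ENNReal.ofReal r) →
          LogDiffusion.MemLinftyLpLoc E T (fun x τ => Real.log (u x τ)) p →
          ∀ (y : LogDiffusion.Sp N) (ρ s t : ℝ), 0 < ρ → s < t →
            LogDiffusion.cube y (2 * ρ) ×ˢ Set.Icc s t ⊆ LogDiffusion.cyl E T →
            (⨆ τ ∈ Set.Ioo s t, LogDiffusion.mass u y ρ τ) ≤
              ENNReal.ofReal
                  (γ (LogDiffusion.Lam u y ρ s t 1) (LogDiffusion.Lam u y ρ s t 2)) *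
                ((⨅ τ ∈ Set.Ioo s t, LogDiffusion.mass u y (2 * ρ) τ) +
                  ENNReal.ofReal ((t - s) / ρ ^ (2 - (N : ℝ))))) ∧
    -- distributional solutions of `u_t - Δ ln u = 0`; these are defined only a.e. in time
    (∀ N : ℕ, 1 ≤ N →
      ∃ γ : ℝ → ℝ, (∀ a, 0 < γ a) ∧
        ∀ (r p : ℝ), max 1 ((N : ℝ) / 2) < r → 1 < p →
        ∀ (E : Set (LogDiffusion.Sp N)) (T : ℝ) (u : LogDiffusion.Sp N → ℝ → ℝ),
          IsOpen E → 0 < T →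
          LogDiffusion.IsDistributionalSolution E T u →
          LogDiffusion.MemLpLoc E T u ⊤ →
          LogDiffusion.MemLpLoc E T u (ENNReal.ofReal r) →
          LogDiffusion.MemLinftyLpLoc E T (fun x τ => Real.log (u x τ)) p →
          ∀ (y : LogDiffusion.Sp N) (ρ s t : ℝ), 0 < ρ → s < t →
            LogDiffusion.cube y (2 * ρ) ×ˢ Set.Icc s t ⊆ LogDiffusion.cyl E T →
            essSup (fun τ => LogDiffusion.mass u y ρ τ)
                (MeasureTheory.volume.restrict (Set.Ioo s t)) ≤
              ENNReal.ofReal (γ (LogDiffusion.Lam u y ρ s t p)) *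
                (essInf (fun τ => LogDiffusion.mass u y (2 * ρ) τ)
                    (MeasureTheory.volume.restrict (Set.Ioo s t)) +
                  ENNReal.ofReal ((t - s) / ρ ^ (2 - (N : ℝ))))) := by
  refine ⟨fun N r p _ _ hp => ?_, fun N r p Co C1 _ _ hp hCo hC1 => ?_, fun N _ => ?_⟩
  · obtain ⟨γ, hγ, H⟩ := LogDiffusion.exists_gamma_quasilinear N hp one_pos one_pos
    exact ⟨γ, hγ, fun E T u hE _ hu hb _ hlog => H E T _ u hE
      (LogDiffusion.structureConditions_inv_smul E T) hu.quasilinear hb hlog⟩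
  · obtain ⟨γ, hγ, H⟩ := LogDiffusion.exists_gamma_quasilinear N hp hCo hC1
    exact ⟨γ, hγ, fun E T A u hE _ hA hu hb _ hlog => H E T A u hE hA hu hb hlog⟩
  · obtain ⟨C, hC, hcut⟩ := LogDiffusion.exists_cutoff N
    -- The absolute value keeps the constant positive for every real argument; it is harmless
    -- because `Lam` is nonnegative.
    refine ⟨fun a => 1 + C * 2 ^ N * |a|, fun a => by positivity, ?_⟩
    intro r p _ hp E T u hE _ hu hb _ hlog y ρ s t hρ hst h
    obtain ⟨η, hη, hηc, hηK, hη01, hη1, -, hΔ⟩ := hcut y ρ hρ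
    have hΛ : 0 ≤ C * 2 ^ N * |LogDiffusion.Lam u y ρ s t p| := by positivity
    refine LogDiffusion.essSup_mass_le (e := C * 2 ^ N * LogDiffusion.Lam u y ρ s t p)
      (by linarith) (div_nonneg (sub_nonneg.2 hst.le) (Real.rpow_nonneg hρ.le _)) ?_
      (hu.ae_mass_le hE hb hlog hp hρ hst h hC hη hηc (hηK.trans interior_subset) hη01 hη1 hΔ)
    simp only [abs_of_nonneg (LogDiffusion.Lam_nonneg u y ρ s t p)]
    linarith
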